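/- Let $0\le\theta_2<\theta_1<\pi$. For $\theta\in\mathbb R$ let $\gamma_\theta=\{\rho(\cos\theta,\sin\theta):\rho>0\}$. For a smooth regular curve $c:[-1,1]\to\mathbb R^2$, $c=c(u)$, let $ds=|c_u|\,du$ be the arclength element, $\partial_s=|c_u|^{-1}\partial_u$ (one-sided derivatives at $u=\pm1$), $\tau=c_s$ the unit tangent, $\nu$ the unit normal obtained by rotating $\tau$ counterclockwise by $\pi/2$ (for a curve running in the cone from $\gamma_{\theta_1}$ to $\gamma_{\theta_2}$ this is the outer normal), $k=-\langle c_{ss},\nu\rangle$ the curvature and $k_{s^m}=\partial_s^m k$. All integrals with respect to $ds$ are along the whole curve. Put $$L=\int ds,\qquad \bar k=\frac1L\int k\,ds,\qquad K_{\rm osc}=L\int (k-\bar k)^2ds,\qquad \omega=\frac1{2\pi}\int k\,ds .$$ The curve $c$ satisfies the generalised Neumann boundary conditions if $c(-1)\in\gamma_{\theta_1}$, $c(1)\in\gamma_{\theta_2}$, $c$ meets the two rays perpendicularly at these endpoints, and $k_s(\pm1)=0$. Let $\alpha_0:[-1,1]\to\mathbb R^2$ be a smooth regular curve which satisfies the generalised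 Neumann boundary conditions, with $\alpha_0(u)\in\{\rho(\cos\theta,\sin\theta):\rho>0,\ \theta_2<\theta<\theta_1\}$ for $-1<u<1$, whose rotation number satisfies $0<\omega<\frac12$, and for which $$K_{\rm osc}[\alpha_0]\le\Big(\frac{\pi}{12}\Big)^2\Big[-24\,\omega+\sqrt{(24\,\omega)^2+\tfrac{48}{\pi}(1-4\omega^2)}\,\Big]^2 .$$ Let $\alpha:[-1,1]\times[0,\infty)\to\mathbb R^2$ be smooth (up to and including the boundary and $t=0$), such that every $\alpha(\cdot,t)$, $t\ge0$, is a regular curve satisfying the generalised Neumann boundary conditions, $\alpha(\cdot,0)=\alpha_0$, and $$\frac{\partial\alpha}{\partial t}=k_{ss}\,\nu\qquad\text{on }[-1,1]\times[0,\infty).$$ Then for every integer $m\ge0$ there is a constant $C_m>0$ such that, along the curves $\alpha(\cdot,t)$, $$\int k_{s^m}^2\,ds\le C_m^2\qquad\text{for all } t\ge0 .$$ -/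

import Mathlib

open scoped ContDiff

noncomputable section

namespace ConeFlow

/-- The Euclidean plane. -/
abbrev Plane : Type := EuclideanSpace ℝ (Fin 2)

/-- The parameter interval of all curves. -/
def I : Set ℝ := Set.Icc (-1) 1

/-! ### Geometry of a single parametrised curve `c : [-1,1] → ℝ²`

Curves are functions on `ℝ`, of which only the values on `[-1,1]` matter: parameter derivatives
are derivatives within `[-1,1]`, hence one-sided at the endpoints. -/

/-- The speed `|c_u|`; the arclength element is `ds = |c_u| du`. -/
def speed (c : ℝ → Plane) (u : ℝ) : ℝ := ‖derivWithin c I u‖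

/-- The arclength derivative `f_s = |c_u|⁻¹ f_u` of a function `f` along the curve `c`. -/
def arcDeriv {E : Type} [NormedAddCommGroup E] [NormedSpace ℝ E]
    (c : ℝ → Plane) (f : ℝ → E) (u : ℝ) : E :=
  (speed c u)⁻¹ • derivWithin f I u

/-- The unit tangent `τ = c_s`. -/
def tangent (c : ℝ → Plane) : ℝ → Plane := arcDeriv c c

/-- Counterclockwise rotation by a right angle, `(x, y) ↦ (-y, x)`. -/
def rotate (v : Plane) : Plane := !₂[-v 1, v 0]

/-- The unit normal `ν`, obtained by rotating the tangent counterclockwise. A curve that runs from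
the ray of larger angle to the ray of smaller angle has the tip of the cone on its right, so
this is the normal pointing out of the region bounded by the curve and the cone. -/
def normal (c : ℝ → Plane) (u : ℝ) : Plane := rotate (tangent c u)

/-- The scalar curvature `k = -⟨c_ss, ν⟩`. -/
def curvature (c : ℝ → Plane) (u : ℝ) : ℝ :=
  -inner ℝ (arcDeriv c (tangent c) u) (normal c u)

/-- The `m`-th iterated arclength derivative `k_{s^m}` of the curvature. -/
def curvatureDeriv (c : ℝ → Plane) (m : ℕ) : ℝ → ℝ := (arcDeriv c)^[m] (curvature c)

/-- The integral `∫ f ds` along the curve. -/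
def arcIntegral (c : ℝ → Plane) (f : ℝ → ℝ) : ℝ := ∫ u in (-1 : ℝ)..1, f u * speed c u

/-- The length `L`. -/
def length (c : ℝ → Plane) : ℝ := arcIntegral c fun _ => 1

/-- The average curvature `(1 / L) ∫ k ds`. -/
def averageCurvature (c : ℝ → Plane) : ℝ := 1 / length c * arcIntegral c (curvature c)

/-- The oscillation of curvature `K_osc = L ∫ (k - k̄)² ds`. -/
def curvatureOsc (c : ℝ → Plane) : ℝ :=
  length c * arcIntegral c fun u => (curvature c u - averageCurvature c) ^ 2

/-- The rotation number `ω = (1 / 2π) ∫ k ds`. -/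
def rotationNumber (c : ℝ → Plane) : ℝ := 1 / (2 * Real.pi) * arcIntegral c (curvature c)

/-- The bound on the oscillation of curvature in the smallness condition. -/
def oscBound (w : ℝ) : ℝ :=
  (Real.pi / 12) ^ 2 *
    (-24 * w + Real.sqrt ((24 * w) ^ 2 + 48 / Real.pi * (1 - 4 * w ^ 2))) ^ 2

/-! ### The cone -/

/-- The point with polar coordinates `(ρ, θ)`. -/
def polar (ρ θ : ℝ) : Plane := !₂[ρ * Real.cos θ, ρ * Real.sin θ]

/-- The open ray at angle `θ`, without the tip. -/
def ray (θ : ℝ) : Set Plane := {p | ∃ ρ : ℝ, 0 < ρ ∧ p = polar ρ θ}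

/-- The open sector between the angles `θ₂ < θ₁`. -/
def sector (θ₁ θ₂ : ℝ) : Set Plane :=
  {p | ∃ ρ θ : ℝ, 0 < ρ ∧ θ₂ < θ ∧ θ < θ₁ ∧ p = polar ρ θ}

/-- A unit vector perpendicular to the ray at angle `θ`. -/
def rayNormal (θ : ℝ) : Plane := !₂[-Real.sin θ, Real.cos θ]

/-- The boundary conditions for one curve: it starts on the ray at angle `θ₁` and ends on the ray
at angle `θ₂` (never at the tip), meets both rays perpendicularly, and `k_s = 0` at both ends. -/
structure GeneralisedNeumann (θ₁ θ₂ : ℝ) (c : ℝ → Plane) : Prop where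
  left_mem : c (-1) ∈ ray θ₁
  right_mem : c 1 ∈ ray θ₂
  left_perp : inner ℝ (normal c (-1)) (rayNormal θ₁) = 0
  right_perp : inner ℝ (normal c 1) (rayNormal θ₂) = 0
  left_flux : curvatureDeriv c 1 (-1) = 0
  right_flux : curvatureDeriv c 1 1 = 0

/-- Initial curves: smooth regular curves on `[-1,1]` with interior inside the cone that satisfy
the generalised Neumann boundary conditions. -/
structure IsInitialCurve (θ₁ θ₂ : ℝ) (c : ℝ → Plane) : Prop where
  smooth : ContDiffOn ℝ ∞ c I
  regular : ∀ u ∈ I, derivWithin c I u ≠ 0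
  inside : ∀ u ∈ Set.Ioo (-1 : ℝ) 1, c u ∈ sector θ₁ θ₂
  boundary : GeneralisedNeumann θ₁ θ₂ c

/-- `α : [-1,1] × [0,∞) → ℝ²` is a (smooth, global) solution `α u t` of the curve diffusion flow
`∂α/∂t = k_ss ν` with generalised Neumann boundary conditions and initial curve `α₀`. -/
structure IsGlobalSolution (θ₁ θ₂ : ℝ) (α₀ : ℝ → Plane) (α : ℝ → ℝ → Plane) : Prop where
  smooth : ContDiffOn ℝ ∞ (fun p : ℝ × ℝ => α p.1 p.2) (I ×ˢ Set.Ici 0)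
  regular : ∀ t, 0 ≤ t → ∀ u ∈ I, derivWithin (fun v => α v t) I u ≠ 0
  initial : ∀ u ∈ I, α u 0 = α₀ u
  flow : ∀ t, 0 ≤ t → ∀ u ∈ I,
    HasDerivWithinAt (fun r => α u r)
      (curvatureDeriv (fun v => α v t) 2 u • normal (fun v => α v t) u) (Set.Ici 0) t
  boundary : ∀ t, 0 ≤ t → GeneralisedNeumann θ₁ θ₂ (fun v => α v t)

end ConeFlow

end

open scoped ContDiff

noncomputable section

namespace ConeFlow

open Set MeasureTheory


/-! ### Calculus on the space-time domain -/

/-! Differentiating the perpendicularity condition in time gives `k_sss = 0` at the endpoints. The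
evolution equations for the derivatives of `k` then make all odd arclength derivatives of `k` vanish
there, so that every integration by parts below has no boundary term. Consequently `L' = -∫ k_s²`,
while `∫ k ds` and the signed area `∫ ⟨γ, ν⟩ ds` are conserved, `γ` being the position.

The oscillation is `K = L ∫ k² - (∫ k)²`. Writing `k` as its mean plus a deviation and applying a
sup bound and Wirtinger's inequality to `k_s` gives `K' ≤ L ‖k_ss‖² (3K/4 + 6ω√K - 2(1 - 4ω²))`. The
smallness condition makes the bracket nonpositive with room to spare, so the initial bound on `K`
persists (`osc_deriv_nonpos`, `osc_le`).

The length cannot shrink to zero: since the endpoints stay on the two rays, the conserved area is at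
most a constant times `L²` (`area_le`). The area is positive at time zero, because small oscillation
turns the initial curve into a graph over a line orthogonal to the bisector of the cone
(`abs_angle_sub_lt`, `area_pos`). Only the initial curve has to lie inside the cone. Bounds on `K`
and `∫ k`, with `L` bounded below, bound `∫ k²`.

For higher derivatives, `d/dt ‖k_m‖²` equals `-2 ‖k_{m+2}‖²` plus integrals of four curvature
factors with `2m + 2` derivatives in all. If `‖k_{m+2}‖ = q^(m+2)` with `q ≥ 1`, interpolation
bounds these integrals by a multiple of `q^(2m+3)`, which the dissipation `2 q^(2m+4)` dominates
once `q` is large (`exists_arcInt_curv_sq_le`). -/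

/-- The space-time domain `[-1,1] × [0,∞)`. -/
def domain : Set (ℝ × ℝ) := I ×ˢ Ici 0

theorem mk_mem_domain {u t : ℝ} (hu : u ∈ Icc (-1 : ℝ) 1) (ht : 0 ≤ t) : (u, t) ∈ domain :=
  ⟨hu, ht⟩

/-- The (one-sided) partial derivative in the parameter `u`. -/
def partialU {E : Type} [NormedAddCommGroup E] [NormedSpace ℝ E] (F : ℝ × ℝ → E) (p : ℝ × ℝ) : E :=
  derivWithin (fun v => F (v, p.2)) I p.1

/-- The (one-sided) partial derivative in time. -/
def partialT {E : Type} [NormedAddCommGroup E] [NormedSpace ℝ E] (F : ℝ × ℝ → E) (p : ℝ × ℝ) : E :=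
  derivWithin (fun r => F (p.1, r)) (Ici 0) p.2

theorem uniqueDiffOn_I : UniqueDiffOn ℝ I := uniqueDiffOn_Icc (by norm_num)

theorem uniqueDiffOn_domain : UniqueDiffOn ℝ domain :=
  uniqueDiffOn_I.prod (uniqueDiffOn_Ici 0)

/-- Lets the symmetry of second derivatives pass from interior points to the boundary of the domain.
-/
theorem domain_subset_closure_interior : domain ⊆ closure (interior domain) := by
  have h : Convex ℝ domain := (convex_Icc _ _).prod (convex_Ici _)
  have hne : (interior domain).Nonempty := by
    refine ⟨(0, 1), ?_⟩
    rw [domain, interior_prod_eq, I, interior_Icc, interior_Ici]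
    simp
  rw [h.closure_interior_eq_closure_of_nonempty_interior hne]
  exact subset_closure

section partials

variable {E : Type} [NormedAddCommGroup E] [NormedSpace ℝ E] {F : ℝ × ℝ → E} {p : ℝ × ℝ}

theorem hasDerivWithinAt_fst_of_fderivWithin {F' : ℝ × ℝ →L[ℝ] E}
    (hF : HasFDerivWithinAt F F' domain p) (hp : p ∈ domain) :
    HasDerivWithinAt (fun v => F (v, p.2)) (F' (1, 0)) I p.1 := by
  have h1 : HasDerivWithinAt (fun v : ℝ => (v, p.2)) ((1 : ℝ), (0 : ℝ)) I p.1 :=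
    (hasDerivWithinAt_id _ _).prodMk (hasDerivWithinAt_const _ _ _)
  exact HasFDerivWithinAt.comp_hasDerivWithinAt (t := domain) p.1 (by exact hF) h1
    fun _ hv => ⟨hv, hp.2⟩

theorem hasDerivWithinAt_snd_of_fderivWithin {F' : ℝ × ℝ →L[ℝ] E}
    (hF : HasFDerivWithinAt F F' domain p) (hp : p ∈ domain) :
    HasDerivWithinAt (fun r => F (p.1, r)) (F' (0, 1)) (Ici 0) p.2 := by
  have h1 : HasDerivWithinAt (fun r : ℝ => (p.1, r)) ((0 : ℝ), (1 : ℝ)) (Ici 0) p.2 :=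
    (hasDerivWithinAt_const _ _ _).prodMk (hasDerivWithinAt_id _ _)
  exact HasFDerivWithinAt.comp_hasDerivWithinAt (t := domain) p.2 (by exact hF) h1
    fun _ hv => ⟨hp.1, hv⟩

theorem partialU_eq (hF : DifferentiableWithinAt ℝ F domain p) (hp : p ∈ domain) :
    partialU F p = fderivWithin ℝ F domain p (1, 0) :=
  (hasDerivWithinAt_fst_of_fderivWithin hF.hasFDerivWithinAt hp).derivWithin
    (uniqueDiffOn_I _ hp.1)

theorem partialT_eq (hF : DifferentiableWithinAt ℝ F domain p) (hp : p ∈ domain) :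
    partialT F p = fderivWithin ℝ F domain p (0, 1) :=
  (hasDerivWithinAt_snd_of_fderivWithin hF.hasFDerivWithinAt hp).derivWithin
    (uniqueDiffOn_Ici 0 _ hp.2)

theorem smooth_differentiable (hF : ContDiffOn ℝ ∞ F domain) : DifferentiableOn ℝ F domain :=
  hF.differentiableOn (by simp)

theorem hasDerivWithinAt_partialU (hF : ContDiffOn ℝ ∞ F domain) (hp : p ∈ domain) :
    HasDerivWithinAt (fun v => F (v, p.2)) (partialU F p) I p.1 := by
  rw [partialU_eq (smooth_differentiable hF p hp) hp]
  exact hasDerivWithinAt_fst_of_fderivWithin (smooth_differentiable hF p hp).hasFDerivWithinAt hp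

theorem hasDerivWithinAt_partialT (hF : ContDiffOn ℝ ∞ F domain) (hp : p ∈ domain) :
    HasDerivWithinAt (fun r => F (p.1, r)) (partialT F p) (Ici 0) p.2 := by
  rw [partialT_eq (smooth_differentiable hF p hp) hp]
  exact hasDerivWithinAt_snd_of_fderivWithin (smooth_differentiable hF p hp).hasFDerivWithinAt hp

theorem partialU_unique {y : E} (hp : p ∈ domain)
    (h : HasDerivWithinAt (fun v => F (v, p.2)) y I p.1) : partialU F p = y :=
  h.derivWithin (uniqueDiffOn_I _ hp.1)

theorem partialT_unique {y : E} (hp : p ∈ domain)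
    (h : HasDerivWithinAt (fun r => F (p.1, r)) y (Ici 0) p.2) : partialT F p = y :=
  h.derivWithin (uniqueDiffOn_Ici 0 _ hp.2)

theorem partialU_congr {G : ℝ × ℝ → E} (h : EqOn F G domain) (hp : p ∈ domain) :
    partialU F p = partialU G p :=
  derivWithin_congr (fun _ hv => h ⟨hv, hp.2⟩) (h ⟨hp.1, hp.2⟩)

theorem partialT_congr {G : ℝ × ℝ → E} (h : EqOn F G domain) (hp : p ∈ domain) :
    partialT F p = partialT G p :=
  derivWithin_congr (fun _ hv => h ⟨hp.1, hv⟩) (h ⟨hp.1, hp.2⟩)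

theorem smooth_fderivWithin (hF : ContDiffOn ℝ ∞ F domain) :
    ContDiffOn ℝ ∞ (fderivWithin ℝ F domain) domain :=
  hF.fderivWithin uniqueDiffOn_domain (by simp)

theorem smooth_partialU (hF : ContDiffOn ℝ ∞ F domain) : ContDiffOn ℝ ∞ (partialU F) domain :=
  ((smooth_fderivWithin hF).clm_apply contDiffOn_const).congr fun p hp =>
    partialU_eq (smooth_differentiable hF p hp) hp

theorem smooth_partialT (hF : ContDiffOn ℝ ∞ F domain) : ContDiffOn ℝ ∞ (partialT F) domain :=
  ((smooth_fderivWithin hF).clm_apply contDiffOn_const).congr fun p hp =>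
    partialT_eq (smooth_differentiable hF p hp) hp

theorem fderivWithin_apply_const (hF : ContDiffOn ℝ ∞ F domain) (hp : p ∈ domain) (v w : ℝ × ℝ) :
    fderivWithin ℝ (fun q => fderivWithin ℝ F domain q v) domain p w =
      fderivWithin ℝ (fderivWithin ℝ F domain) domain p w v := by
  have h := (smooth_differentiable (smooth_fderivWithin hF) p hp).hasFDerivWithinAt
  have h2 := h.clm_apply (hasFDerivWithinAt_const v p domain)
  rw [h2.fderivWithin (uniqueDiffOn_domain p hp)]
  simp

theorem partialT_partialU (hF : ContDiffOn ℝ ∞ F domain) (hp : p ∈ domain) :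
    partialT (partialU F) p = partialU (partialT F) p := by
  rw [partialT_eq (smooth_differentiable (smooth_partialU hF) p hp) hp,
    partialU_eq (smooth_differentiable (smooth_partialT hF) p hp) hp,
    fderivWithin_congr (fun q hq => partialU_eq (smooth_differentiable hF q hq) hq)
      (partialU_eq (smooth_differentiable hF p hp) hp),
    fderivWithin_congr (fun q hq => partialT_eq (smooth_differentiable hF q hq) hq)
      (partialT_eq (smooth_differentiable hF p hp) hp),
    fderivWithin_apply_const hF hp, fderivWithin_apply_const hF hp]
  exact (hF p hp).isSymmSndFDerivWithinAt (by simpa using WithTop.coe_le_coe.2 (le_top : (2 : ℕ∞) ≤ ⊤)) uniqueDiffOn_domain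
    (domain_subset_closure_interior hp) hp _ _

end partials

/-! ### Differentiation under the integral sign -/

/-- The retraction of the plane onto the space-time domain. -/
def clampDomain (p : ℝ × ℝ) : ℝ × ℝ := (max (-1) (min p.1 1), max 0 p.2)

theorem continuous_clampDomain : Continuous clampDomain := by
  unfold clampDomain; fun_prop

theorem clampDomain_mem (p : ℝ × ℝ) : clampDomain p ∈ domain := by
  exact mk_mem_domain ⟨le_max_left _ _, max_le (by norm_num) (min_le_right _ _)⟩
    (le_max_left _ _)

theorem clampDomain_of_mem {p : ℝ × ℝ} (hp : p ∈ domain) : clampDomain p = p := by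
  obtain ⟨⟨h1, h2⟩, h3⟩ := hp
  have h3 : 0 ≤ p.2 := h3
  ext <;> simp [clampDomain, h1, h2, h3]

/-- Composing with the retraction extends the integrand continuously to the plane without changing
its integrals at times `t ≥ 0`. -/
theorem continuous_comp_clampDomain {H : ℝ × ℝ → ℝ} (hH : ContinuousOn H domain) :
    Continuous fun p => H (clampDomain p) :=
  hH.comp_continuous continuous_clampDomain clampDomain_mem

theorem integral_clampDomain (H : ℝ × ℝ → ℝ) {t : ℝ} (ht : 0 ≤ t) :
    ∫ u in (-1 : ℝ)..1, H (clampDomain (u, t)) = ∫ u in (-1 : ℝ)..1, H (u, t) := by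
  apply intervalIntegral.integral_congr
  intro u hu
  rw [uIcc_of_le (by norm_num)] at hu
  simp only
  rw [clampDomain_of_mem (mk_mem_domain hu ht)]

theorem continuousOn_integral {H : ℝ × ℝ → ℝ} (hH : ContinuousOn H domain) :
    ContinuousOn (fun t => ∫ u in (-1 : ℝ)..1, H (u, t)) (Ici 0) := by
  have h : Continuous fun t : ℝ => ∫ u in (-1 : ℝ)..1, H (clampDomain (u, t)) := by
    apply intervalIntegral.continuous_parametric_intervalIntegral_of_continuous'
    exact (continuous_comp_clampDomain hH).comp continuous_swap
  exact h.continuousOn.congr fun t ht => (integral_clampDomain H ht).symm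

theorem hasDerivAt_integral {H : ℝ × ℝ → ℝ} (hH : ContDiffOn ℝ ∞ H domain) {t : ℝ} (ht : 0 < t) :
    HasDerivAt (fun t => ∫ u in (-1 : ℝ)..1, H (u, t))
      (∫ u in (-1 : ℝ)..1, partialT H (u, t)) t := by
  have hc := continuous_comp_clampDomain hH.continuousOn
  have hc' := continuous_comp_clampDomain (smooth_partialT hH).continuousOn
  -- The compact time window `[t/2, 2t]` avoids `0`, where time derivatives are only one-sided, and
  -- supplies a constant dominating function.
  obtain ⟨B, hB⟩ := ((isCompact_Icc (a := (-1 : ℝ)) (b := 1)).prod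
    (isCompact_Icc (a := t / 2) (b := 2 * t))).exists_bound_of_continuousOn hc'.continuousOn
  have hs : Icc (t / 2) (2 * t) ∈ nhds t := Icc_mem_nhds (by linarith) (by linarith)
  have key := intervalIntegral.hasDerivAt_integral_of_dominated_loc_of_deriv_le
    (μ := volume) (a := -1) (b := 1) (F := fun r u => H (clampDomain (u, r)))
    (F' := fun r u => partialT H (clampDomain (u, r))) (x₀ := t) (bound := fun _ => B) hs
    (Filter.Eventually.of_forall fun r => by
      apply Continuous.aestronglyMeasurable
      exact hc.comp (by fun_prop : Continuous fun u : ℝ => (u, r)))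
    (by
      apply Continuous.intervalIntegrable
      exact hc.comp (by fun_prop : Continuous fun u : ℝ => (u, t)))
    (by
      apply Continuous.aestronglyMeasurable
      exact hc'.comp (by fun_prop : Continuous fun u : ℝ => (u, t)))
    (by
      refine Filter.Eventually.of_forall fun u hu r hr => ?_
      rw [uIoc_of_le (by norm_num)] at hu
      exact hB (u, r) ⟨⟨hu.1.le, hu.2⟩, hr⟩)
    (by simp)
    (by
      refine Filter.Eventually.of_forall fun u hu r hr => ?_
      rw [uIoc_of_le (by norm_num)] at hu
      have hr0 : 0 < r := by have := hr.1; linarith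
      have hp : (u, r) ∈ domain := mk_mem_domain ⟨hu.1.le, hu.2⟩ hr0.le
      rw [clampDomain_of_mem hp]
      have h1 := (hasDerivWithinAt_partialT hH hp).hasDerivAt (Ici_mem_nhds hr0)
      refine h1.congr_of_eventuallyEq ?_
      filter_upwards [Ioi_mem_nhds hr0] with q hq
      rw [clampDomain_of_mem (mk_mem_domain ⟨hu.1.le, hu.2⟩ (le_of_lt hq))])
  have h2 := key.2
  rw [integral_clampDomain _ ht.le] at h2
  refine h2.congr_of_eventuallyEq ?_
  filter_upwards [Ioi_mem_nhds ht] with q hq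
  rw [integral_clampDomain _ (le_of_lt hq)]


/-! ### Weighted calculus on the parameter interval

The weight `v` plays the role of the speed of a curve: `f'` is the arclength derivative of `f`
if `f' * v` is its parameter derivative. -/

/-- `f'` is a continuous arclength derivative of `f` with respect to the arclength `v du`. -/
structure HasArcDeriv (v f f' : ℝ → ℝ) : Prop where
  deriv : ∀ u ∈ I, HasDerivWithinAt f (f' u * v u) I u
  cont : ContinuousOn f' I

theorem HasArcDeriv.continuousOn {v f f' : ℝ → ℝ} (h : HasArcDeriv v f f') : ContinuousOn f I :=
  fun u hu => (h.deriv u hu).continuousWithinAt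

theorem intervalIntegrable_of_continuousOn {g : ℝ → ℝ} (hg : ContinuousOn g I) {a b : ℝ}
    (ha : a ∈ I) (hb : b ∈ I) : IntervalIntegrable g volume a b :=
  (hg.mono (Set.uIcc_subset_Icc ha hb)).intervalIntegrable

theorem left_mem_I : (-1 : ℝ) ∈ I := ⟨le_rfl, by norm_num⟩

theorem right_mem_I : (1 : ℝ) ∈ I := ⟨by norm_num, le_rfl⟩

theorem integral_of_hasDerivWithinAt {f g : ℝ → ℝ} (hf : ∀ u ∈ I, HasDerivWithinAt f (g u) I u)
    (hg : ContinuousOn g I) {a b : ℝ} (ha : a ∈ I) (hb : b ∈ I) (hab : a ≤ b) :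
    ∫ u in a..b, g u = f b - f a := by
  have hsub : Icc a b ⊆ I := Icc_subset_Icc ha.1 hb.2
  refine intervalIntegral.integral_eq_sub_of_hasDerivAt_of_le hab
    (fun u hu => ((hf u (hsub hu)).continuousWithinAt).mono hsub) (fun u hu => ?_)
    (intervalIntegrable_of_continuousOn hg ha hb)
  exact (hf u (hsub ⟨hu.1.le, hu.2.le⟩)).hasDerivAt
    (Icc_mem_nhds (lt_of_le_of_lt ha.1 hu.1) (lt_of_lt_of_le hu.2 hb.2))

theorem exists_primitive {g : ℝ → ℝ} (hg : ContinuousOn g I) :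
    ∃ G : ℝ → ℝ, G (-1) = 0 ∧ ∀ u ∈ I, HasDerivWithinAt G (g u) I u := by
  have hle : (-1 : ℝ) ≤ 1 := by norm_num
  have hc : Continuous (IccExtend hle (I.domRestrict g)) :=
    (continuousOn_iff_continuous_domRestrict.1 hg).Icc_extend'
  refine ⟨fun u => ∫ x in (-1 : ℝ)..u, IccExtend hle (I.domRestrict g) x, by simp, fun u hu => ?_⟩
  have h := (hc.integral_hasStrictDerivAt (-1) u).hasDerivAt.hasDerivWithinAt (s := I)
  have e : IccExtend hle (I.domRestrict g) u = g u := IccExtend_of_mem hle _ hu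
  rwa [e] at h

theorem integral_nonneg_I {g : ℝ → ℝ} (h : ∀ u ∈ I, 0 ≤ g u) {a b : ℝ}
    (ha : a ∈ I) (hb : b ∈ I) (hab : a ≤ b) : 0 ≤ ∫ u in a..b, g u :=
  intervalIntegral.integral_nonneg hab fun u hu => h u (Icc_subset_Icc ha.1 hb.2 hu)

theorem integral_mono_I {f g : ℝ → ℝ} (hf : ContinuousOn f I) (hg : ContinuousOn g I)
    (h : ∀ u ∈ I, f u ≤ g u) :
    ∫ u in (-1 : ℝ)..1, f u ≤ ∫ u in (-1 : ℝ)..1, g u :=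
  intervalIntegral.integral_mono_on (by norm_num)
    (intervalIntegrable_of_continuousOn hf left_mem_I right_mem_I)
    (intervalIntegrable_of_continuousOn hg left_mem_I right_mem_I) h

theorem integral_lincomb_I {f g : ℝ → ℝ} (hf : ContinuousOn f I) (hg : ContinuousOn g I)
    {a b : ℝ} (ha : a ∈ I) (hb : b ∈ I) (x y : ℝ) :
    ∫ u in a..b, (x * f u + y * g u) = x * (∫ u in a..b, f u) + y * ∫ u in a..b, g u := by
  rw [intervalIntegral.integral_add, intervalIntegral.integral_const_mul,
    intervalIntegral.integral_const_mul]
  · exact (intervalIntegrable_of_continuousOn hf ha hb).const_mul _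
  · exact (intervalIntegrable_of_continuousOn hg ha hb).const_mul _

theorem cauchy_schwarz {v f g : ℝ → ℝ} (hv : ContinuousOn v I) (hv0 : ∀ u ∈ I, 0 ≤ v u)
    (hf : ContinuousOn f I) (hg : ContinuousOn g I) {a b : ℝ} (ha : a ∈ I) (hb : b ∈ I)
    (hab : a ≤ b) :
    (∫ u in a..b, f u * g u * v u) ^ 2 ≤
      (∫ u in a..b, f u ^ 2 * v u) * ∫ u in a..b, g u ^ 2 * v u := by
  -- The quadratic `x ↦ ∫ (x f + g)² v` is nonnegative, so its discriminant is at most zero.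
  have key : ∀ x : ℝ, 0 ≤ (∫ u in a..b, f u ^ 2 * v u) * (x * x) +
      (2 * ∫ u in a..b, f u * g u * v u) * x + ∫ u in a..b, g u ^ 2 * v u := by
    intro x
    have h0 : 0 ≤ ∫ u in a..b, (x * f u + g u) ^ 2 * v u :=
      integral_nonneg_I (fun u hu => mul_nonneg (sq_nonneg _) (hv0 u hu)) ha hb hab
    have h1 : ∫ u in a..b, (x * f u + g u) ^ 2 * v u =
        ∫ u in a..b, (1 * (x ^ 2 * (f u ^ 2 * v u) + (2 * x) * (f u * g u * v u)) +
          1 * (g u ^ 2 * v u)) := by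
      congr 1; ext u; ring
    rw [h1, integral_lincomb_I (by fun_prop) (by fun_prop) ha hb,
      integral_lincomb_I (by fun_prop) (by fun_prop) ha hb] at h0
    linarith
  have := discrim_le_zero key
  rw [discrim] at this
  nlinarith

section weighted

variable {v f f' f'' g g' : ℝ → ℝ}

theorem HasArcDeriv.integral (h : HasArcDeriv v f f') (hv : ContinuousOn v I) :
    ∫ u in (-1 : ℝ)..1, f' u * v u = f 1 - f (-1) :=
  integral_of_hasDerivWithinAt h.deriv (h.cont.mul hv) left_mem_I right_mem_I (by norm_num)

theorem HasArcDeriv.mul (hf : HasArcDeriv v f f') (hg : HasArcDeriv v g g') :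
    HasArcDeriv v (fun u => f u * g u) (fun u => f' u * g u + f u * g' u) where
  deriv u hu := ((hf.deriv u hu).mul (hg.deriv u hu)).congr_deriv (by ring)
  cont := (hf.cont.mul hg.continuousOn).add (hf.continuousOn.mul hg.cont)

/-- Integration by parts. -/
theorem HasArcDeriv.integral_mul (hf : HasArcDeriv v f f') (hg : HasArcDeriv v g g')
    (hv : ContinuousOn v I) :
    ∫ u in (-1 : ℝ)..1, f u * g' u * v u =
      f 1 * g 1 - f (-1) * g (-1) - ∫ u in (-1 : ℝ)..1, f' u * g u * v u := by
  have h := (hf.mul hg).integral hv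
  have h1 : ∫ u in (-1 : ℝ)..1, (f' u * g u + f u * g' u) * v u =
      ∫ u in (-1 : ℝ)..1, (1 * (f' u * g u * v u) + 1 * (f u * g' u * v u)) := by
    congr 1; ext u; ring
  have := hf.cont
  have := hg.cont
  have := hf.continuousOn
  have := hg.continuousOn
  rw [h1, integral_lincomb_I (by fun_prop) (by fun_prop) left_mem_I right_mem_I] at h
  linarith

/-- `‖f_s‖⁴ ≤ ‖f‖² ‖f_ss‖²` if `f f_s` vanishes at the endpoints. -/
theorem sq_integral_deriv_le (hf : HasArcDeriv v f f') (hf' : HasArcDeriv v f' f'')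
    (hv : ContinuousOn v I) (hv0 : ∀ u ∈ I, 0 ≤ v u)
    (h1 : f (-1) * f' (-1) = 0) (h2 : f 1 * f' 1 = 0) :
    (∫ u in (-1 : ℝ)..1, f' u ^ 2 * v u) ^ 2 ≤
      (∫ u in (-1 : ℝ)..1, f u ^ 2 * v u) * ∫ u in (-1 : ℝ)..1, f'' u ^ 2 * v u := by
  have h := hf.integral_mul hf' hv
  have e : ∫ u in (-1 : ℝ)..1, f' u ^ 2 * v u = ∫ u in (-1 : ℝ)..1, f' u * f' u * v u := by
    congr 1; ext u; ring
  have cs := cauchy_schwarz hv hv0 hf.continuousOn hf'.cont left_mem_I right_mem_I (by norm_num)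
  rw [h, h1, h2] at cs
  rw [e]
  linarith

/-- Expand the product: the diagonal terms are each at least `y`, and by AM-GM the mixed ones sum to
at least `2 √(s₁ E₁ s₂ E₂) ≥ 2y`. This produces the factor `1/4` in `sq_le_of_dirichlet`. -/
theorem four_mul_sq_le_of_splits {y s₁ s₂ E₁ E₂ : ℝ} (hs₁ : 0 ≤ s₁) (hs₂ : 0 ≤ s₂) (hE₁ : 0 ≤ E₁)
    (hE₂ : 0 ≤ E₂) (hy : 0 ≤ y) (h₁ : y ≤ s₁ * E₁) (h₂ : y ≤ s₂ * E₂) :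
    4 * y ≤ (s₁ + s₂) * (E₁ + E₂) := by
  have h3 : y * y ≤ (s₁ * E₁) * (s₂ * E₂) := mul_le_mul h₁ h₂ hy (by positivity)
  have h4 : 2 * y ≤ s₁ * E₂ + s₂ * E₁ := by
    apply le_of_sq_le_sq _ (by positivity)
    nlinarith [sq_nonneg (s₁ * E₂ - s₂ * E₁)]
  nlinarith

/-- `‖f‖_∞² ≤ (L / 4) ‖f_s‖²` for functions that vanish at both endpoints. -/
theorem sq_le_of_dirichlet (hf : HasArcDeriv v f f')
    (hv : ContinuousOn v I) (hv0 : ∀ u ∈ I, 0 ≤ v u) (h1 : f (-1) = 0) (h2 : f 1 = 0)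
    {u : ℝ} (hu : u ∈ I) :
    f u ^ 2 ≤ (∫ x in (-1 : ℝ)..1, v x) / 4 * ∫ x in (-1 : ℝ)..1, f' x ^ 2 * v x := by
  have hc' := hf.cont
  have hE : ContinuousOn (fun x => f' x ^ 2 * v x) I := by fun_prop
  have half : ∀ a b : ℝ, a ∈ I → b ∈ I → a ≤ b →
      (f b - f a) ^ 2 ≤ (∫ x in a..b, v x) * ∫ x in a..b, f' x ^ 2 * v x := by
    -- Cauchy–Schwarz against the constant `1`; it is applied on both sides of `u`, since `f`
    -- vanishes at both ends.
    intro a b ha hb hab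
    have cs := cauchy_schwarz (f := fun _ => 1) hv hv0 continuousOn_const hf.cont ha hb hab
    simp only [one_mul, one_pow] at cs
    rwa [integral_of_hasDerivWithinAt hf.deriv (hf.cont.mul hv) ha hb hab] at cs
  have a1 := half (-1) u left_mem_I hu hu.1
  have a2 := half u 1 hu right_mem_I hu.2
  have e1 := intervalIntegral.integral_add_adjacent_intervals
    (intervalIntegrable_of_continuousOn hv left_mem_I hu)
    (intervalIntegrable_of_continuousOn hv hu right_mem_I)
  have e2 := intervalIntegral.integral_add_adjacent_intervals
    (intervalIntegrable_of_continuousOn hE left_mem_I hu)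
    (intervalIntegrable_of_continuousOn hE hu right_mem_I)
  have hE0 : ∀ x ∈ I, 0 ≤ f' x ^ 2 * v x := fun x hx => mul_nonneg (sq_nonneg _) (hv0 x hx)
  have := four_mul_sq_le_of_splits (y := f u ^ 2) (integral_nonneg_I hv0 left_mem_I hu hu.1)
    (integral_nonneg_I hv0 hu right_mem_I hu.2) (integral_nonneg_I hE0 left_mem_I hu hu.1)
    (integral_nonneg_I hE0 hu right_mem_I hu.2) (sq_nonneg _)
    (by simpa [h1] using a1) (by simpa [h2] using a2)
  rw [e1, e2] at this
  linarith

/-- `‖f‖_∞² ≤ ‖f‖² / L + 2 ‖f‖ ‖f_s‖`. -/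
theorem sq_le_of_norms (hf : HasArcDeriv v f f')
    (hv : ContinuousOn v I) (hv0 : ∀ u ∈ I, 0 ≤ v u) (hL : 0 < ∫ x in (-1 : ℝ)..1, v x)
    {u : ℝ} (hu : u ∈ I) :
    f u ^ 2 ≤ (∫ x in (-1 : ℝ)..1, f x ^ 2 * v x) / (∫ x in (-1 : ℝ)..1, v x) +
      2 * (√(∫ x in (-1 : ℝ)..1, f x ^ 2 * v x) * √(∫ x in (-1 : ℝ)..1, f' x ^ 2 * v x)) := by
  have hc := hf.continuousOn
  have hc' := hf.cont
  set M := ∫ x in (-1 : ℝ)..1, |f x| * |f' x| * v x with hM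
  have hM1 : M ≤ √(∫ x in (-1 : ℝ)..1, f x ^ 2 * v x) * √(∫ x in (-1 : ℝ)..1, f' x ^ 2 * v x) := by
    rw [← Real.sqrt_mul (integral_nonneg_I
      (fun x hx => mul_nonneg (sq_nonneg _) (hv0 x hx)) left_mem_I right_mem_I (by norm_num))]
    apply Real.le_sqrt_of_sq_le
    have cs := cauchy_schwarz hv hv0 hc.abs hc'.abs left_mem_I right_mem_I (by norm_num)
    simpa only [sq_abs] using cs
  -- The function `f²` varies by at most `2 ∫ |f f_s|`; averaging the resulting inequality over `w`
  -- with weight `v` gives the claim.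
  have hw : ∀ w ∈ I, f u ^ 2 - 2 * M ≤ f w ^ 2 := by
    intro w hw
    have hcont : ContinuousOn (fun x => f' x * f x + f x * f' x) I := by fun_prop
    have h3 : ∀ a b : ℝ, a ∈ I → b ∈ I → a ≤ b → |f b * f b - f a * f a| ≤ 2 * M := by
      intro a b ha hb hab
      rw [← integral_of_hasDerivWithinAt (hf.mul hf).deriv (hcont.mul hv) ha hb hab]
      refine (intervalIntegral.abs_integral_le_integral_abs hab).trans ?_
      have hci : ContinuousOn (fun x => |(f' x * f x + f x * f' x) * v x|) I := by fun_prop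
      refine (intervalIntegral.integral_mono_interval (c := -1) (d := 1) ha.1 hab hb.2
        (Filter.Eventually.of_forall fun x => abs_nonneg _)
        (intervalIntegrable_of_continuousOn hci left_mem_I right_mem_I)).trans ?_
      rw [hM, ← intervalIntegral.integral_const_mul]
      refine integral_mono_I hci (by fun_prop) fun x hx => ?_
      rw [abs_mul, abs_of_nonneg (hv0 x hx), mul_comm (f' x), ← two_mul, abs_mul, abs_mul]
      norm_num [mul_assoc]
    rcases le_total w u with h | h
    · have := (abs_le.1 (h3 w u hw hu h)).2
      nlinarith
    · have := (abs_le.1 (h3 u w hu hw h)).1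
      nlinarith
  have h4 : (f u ^ 2 - 2 * M) * (∫ x in (-1 : ℝ)..1, v x) ≤ ∫ x in (-1 : ℝ)..1, f x ^ 2 * v x := by
    rw [← intervalIntegral.integral_const_mul]
    exact integral_mono_I (by fun_prop) (by fun_prop)
      fun x hx => mul_le_mul_of_nonneg_right (hw x hx) (hv0 x hx)
  rw [← le_div_iff₀ hL] at h4
  linarith

/-- Wirtinger's inequality for functions that vanish at both endpoints. -/
theorem wirtinger (hf : HasArcDeriv v f f')
    (hv : ContinuousOn v I) (hv0 : ∀ u ∈ I, 0 ≤ v u) (hL : 0 < ∫ x in (-1 : ℝ)..1, v x)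
    (h1 : f (-1) = 0) (h2 : f 1 = 0) :
    ∫ x in (-1 : ℝ)..1, f x ^ 2 * v x ≤
      ((∫ x in (-1 : ℝ)..1, v x) / Real.pi) ^ 2 * ∫ x in (-1 : ℝ)..1, f' x ^ 2 * v x := by
  set L := ∫ x in (-1 : ℝ)..1, v x
  have hc := hf.continuousOn
  have hc' := hf.cont
  obtain ⟨s, hs0, hs⟩ := exists_primitive hv
  have hs1 : ∀ u ∈ I, 0 ≤ s u ∧ s u ≤ L := by
    intro u hu
    have a1 := integral_of_hasDerivWithinAt hs hv left_mem_I hu hu.1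
    have a2 := integral_of_hasDerivWithinAt hs hv hu right_mem_I hu.2
    have a3 := integral_of_hasDerivWithinAt hs hv left_mem_I right_mem_I (by norm_num)
    have b1 := integral_nonneg_I hv0 left_mem_I hu hu.1
    have b2 := integral_nonneg_I hv0 hu right_mem_I hu.2
    change L = _ at a3
    constructor <;> linarith
  have hscont : ContinuousOn s I := fun u hu => (hs u hu).continuousWithinAt
  -- Riccati argument: `w = -λ tan(λ (s - L/2))` satisfies `w_s = -λ² - w²`, so integrating `(f_s -
  -- f w)² ≥ 0` and discarding `(f² w)_s` leaves the inequality. The strict bound `λ < π / L` keeps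
  -- the tangent finite up to both endpoints; the sharp constant follows by letting `λ` increase to
  -- `π / L`.
  have key : ∀ lam : ℝ, 0 < lam → lam < Real.pi / L →
      lam ^ 2 * (∫ x in (-1 : ℝ)..1, f x ^ 2 * v x) ≤ ∫ x in (-1 : ℝ)..1, f' x ^ 2 * v x := by
    intro lam h0 hlt
    have hlL : lam * L < Real.pi := (lt_div_iff₀ hL).1 hlt
    set z : ℝ → ℝ := fun u => lam * (s u - L / 2)
    have hcos : ∀ u ∈ I, Real.cos (z u) ≠ 0 := by
      intro u hu
      obtain ⟨p, q⟩ := hs1 u hu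
      refine (Real.cos_pos_of_mem_Ioo ⟨?_, ?_⟩).ne' <;> simp only [z] <;> nlinarith
    have hz : ContinuousOn z I := by fun_prop
    have hw : HasArcDeriv v (fun u => -lam * Real.tan (z u))
        (fun u => -lam ^ 2 - (-lam * Real.tan (z u)) ^ 2) := by
      have hdw : ∀ u ∈ I, HasDerivWithinAt (fun u => -lam * Real.tan (z u))
          ((-lam ^ 2 - (-lam * Real.tan (z u)) ^ 2) * v u) I u := by
        intro u hu
        have hz' : HasDerivWithinAt z (lam * v u) I u := ((hs u hu).sub_const _).const_mul lam
        have := ((Real.hasDerivAt_tan (hcos u hu)).comp_hasDerivWithinAt u hz').const_mul (-lam)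
        refine this.congr_deriv ?_
        have hcu := hcos u hu
        rw [Real.tan_eq_sin_div_cos]
        field_simp
        have := Real.sin_sq_add_cos_sq (z u)
        linear_combination v u * this
      refine ⟨hdw, ?_⟩
      have hwc : ContinuousOn (fun u => -lam * Real.tan (z u)) I :=
        fun u hu => (hdw u hu).continuousWithinAt
      exact continuousOn_const.sub (hwc.pow 2)
    have hprod := ((hf.mul hf).mul hw).integral hv
    simp only [h1, h2] at hprod
    have hwc := hw.continuousOn
    set w : ℝ → ℝ := fun u => -lam * Real.tan (z u)
    have h5 : 0 ≤ ∫ x in (-1 : ℝ)..1, (f' x - f x * w x) ^ 2 * v x :=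
      integral_nonneg_I (fun x hx => mul_nonneg (sq_nonneg _) (hv0 x hx))
        left_mem_I right_mem_I (by norm_num)
    have h6 : ∫ x in (-1 : ℝ)..1, (f' x - f x * w x) ^ 2 * v x =
        ∫ x in (-1 : ℝ)..1, (1 * (1 * (f' x ^ 2 * v x) + (-lam ^ 2) * (f x ^ 2 * v x)) +
          (-1) * (((f' x * f x + f x * f' x) * w x + f x * f x * (-lam ^ 2 - w x ^ 2)) * v x)) := by
      congr 1; ext x; ring
    rw [h6, integral_lincomb_I (by fun_prop) (by fun_prop) left_mem_I right_mem_I,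
      integral_lincomb_I (by fun_prop) (by fun_prop) left_mem_I right_mem_I, hprod] at h5
    linarith
  have hpL : 0 < Real.pi / L := div_pos Real.pi_pos hL
  have hlim : (Real.pi / L) ^ 2 * (∫ x in (-1 : ℝ)..1, f x ^ 2 * v x) ≤
      ∫ x in (-1 : ℝ)..1, f' x ^ 2 * v x := by
    have ht : Filter.Tendsto (fun lam : ℝ => lam ^ 2 * (∫ x in (-1 : ℝ)..1, f x ^ 2 * v x))
        (nhdsWithin (Real.pi / L) (Iio (Real.pi / L)))
        (nhds ((Real.pi / L) ^ 2 * (∫ x in (-1 : ℝ)..1, f x ^ 2 * v x))) :=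
      (Continuous.tendsto (by fun_prop) _).mono_left nhdsWithin_le_nhds
    refine le_of_tendsto ht ?_
    filter_upwards [Ioo_mem_nhdsLT hpL] with lam hlam using key lam hlam.1 hlam.2
  have h7 : (L / Real.pi) ^ 2 * (Real.pi / L) ^ 2 = 1 := by
    have := Real.pi_pos
    field_simp
  calc _ = (L / Real.pi) ^ 2 * ((Real.pi / L) ^ 2 * (∫ x in (-1 : ℝ)..1, f x ^ 2 * v x)) := by
        rw [← mul_assoc, h7, one_mul]
    _ ≤ _ := by gcongr

end weighted


/-! ### Plane geometry -/

theorem inner_plane (x y : Plane) : inner ℝ x y = x 0 * y 0 + x 1 * y 1 := by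
  simp [PiLp.inner_apply, Fin.sum_univ_two, mul_comm]

theorem rotate_zero_coord (x : Plane) : rotate x 0 = -x 1 := by simp [rotate]

theorem rotate_one_coord (x : Plane) : rotate x 1 = x 0 := by simp [rotate]

theorem plane_ext {x y : Plane} (h0 : x 0 = y 0) (h1 : x 1 = y 1) : x = y := by
  ext i; fin_cases i <;> assumption

/-- The rotation by a right angle as a continuous linear map. -/
def rotateL : Plane →L[ℝ] Plane :=
  LinearMap.toContinuousLinearMap
    { toFun := rotate
      map_add' := fun x y => by
        apply plane_ext <;> simp [rotate_zero_coord, rotate_one_coord]; ring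
      map_smul' := fun a x => by
        apply plane_ext <;> simp [rotate_zero_coord, rotate_one_coord] }

theorem rotateL_apply (x : Plane) : rotateL x = rotate x := rfl

theorem rotate_rotate (x : Plane) : rotate (rotate x) = -x := by
  apply plane_ext <;> simp [rotate_zero_coord, rotate_one_coord]

theorem inner_rotate_self (x : Plane) : inner ℝ x (rotate x) = 0 := by
  rw [inner_plane, rotate_zero_coord, rotate_one_coord]; ring

theorem inner_rotate_rotate (x y : Plane) : inner ℝ (rotate x) (rotate y) = inner ℝ x y := by
  simp only [inner_plane, rotate_zero_coord, rotate_one_coord]; ring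

theorem plane_decomposition {x : Plane} (hx : inner ℝ x x = 1) (w : Plane) :
    w = inner ℝ w x • x + inner ℝ w (rotate x) • rotate x := by
  rw [inner_plane] at hx
  apply plane_ext <;>
    simp only [inner_plane, rotate_zero_coord, rotate_one_coord, PiLp.add_apply, PiLp.smul_apply,
      smul_eq_mul]
  · linear_combination (-w 0) * hx
  · linear_combination (-w 1) * hx

/-! ### Geometric quantities along a family of curves -/

section family

variable (α : ℝ → ℝ → Plane)

/-- The speed as a function on space-time. -/
def spd (p : ℝ × ℝ) : ℝ := speed (fun v => α v p.2) p.1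

/-- The arclength derivative of a function on space-time. -/
def arcD {E : Type} [NormedAddCommGroup E] [NormedSpace ℝ E] (F : ℝ × ℝ → E) (p : ℝ × ℝ) : E :=
  arcDeriv (fun v => α v p.2) (fun v => F (v, p.2)) p.1

/-- The position as a function on space-time. -/
def pos (p : ℝ × ℝ) : Plane := α p.1 p.2

/-- The unit tangent as a function on space-time. -/
def tan (p : ℝ × ℝ) : Plane := tangent (fun v => α v p.2) p.1

/-- The unit normal as a function on space-time. -/
def nor (p : ℝ × ℝ) : Plane := normal (fun v => α v p.2) p.1

/-- The `m`-th arclength derivative of the curvature as a function on space-time. -/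
def curv (m : ℕ) (p : ℝ × ℝ) : ℝ := curvatureDeriv (fun v => α v p.2) m p.1

/-- A smooth family of regular curves. -/
structure IsRegularFamily : Prop where
  smooth : ContDiffOn ℝ ∞ (pos α) domain
  regular : ∀ p ∈ domain, partialU (pos α) p ≠ 0

theorem arcD_def {E : Type} [NormedAddCommGroup E] [NormedSpace ℝ E] (F : ℝ × ℝ → E) (p : ℝ × ℝ) :
    arcD α F p = (spd α p)⁻¹ • partialU F p := rfl

theorem tan_eq (p : ℝ × ℝ) : tan α p = arcD α (pos α) p := rfl

theorem nor_eq (p : ℝ × ℝ) : nor α p = rotate (tan α p) := rfl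

theorem spd_eq (p : ℝ × ℝ) : spd α p = ‖partialU (pos α) p‖ := rfl

theorem curv_zero (p : ℝ × ℝ) : curv α 0 p = -inner ℝ (arcD α (tan α) p) (nor α p) := rfl

theorem curv_succ (m : ℕ) (p : ℝ × ℝ) : curv α (m + 1) p = arcD α (curv α m) p := by
  simp only [curv, curvatureDeriv, Function.iterate_succ_apply', arcD]

end family

namespace IsRegularFamily

variable {α : ℝ → ℝ → Plane} (h : IsRegularFamily α)
  {E : Type} [NormedAddCommGroup E] [NormedSpace ℝ E] {F G : ℝ × ℝ → E} {f g : ℝ × ℝ → ℝ}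
  {X Y : ℝ × ℝ → Plane} {p : ℝ × ℝ}

include h

theorem spd_pos (hp : p ∈ domain) : 0 < spd α p := norm_pos_iff.2 (h.regular p hp)

theorem smooth_spd : ContDiffOn ℝ ∞ (spd α) domain :=
  (smooth_partialU h.smooth).norm ℝ h.regular

theorem smooth_arcD (hF : ContDiffOn ℝ ∞ F domain) : ContDiffOn ℝ ∞ (arcD α F) domain :=
  (h.smooth_spd.inv fun _ hp => (h.spd_pos hp).ne').smul (smooth_partialU hF)

theorem smooth_tan : ContDiffOn ℝ ∞ (tan α) domain := h.smooth_arcD h.smooth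

theorem smooth_nor : ContDiffOn ℝ ∞ (nor α) domain :=
  rotateL.contDiff.comp_contDiffOn h.smooth_tan

theorem smooth_curv (m : ℕ) : ContDiffOn ℝ ∞ (curv α m) domain := by
  induction m with
  | zero => exact ((h.smooth_arcD h.smooth_tan).inner ℝ h.smooth_nor).neg
  | succ m ih => exact (h.smooth_arcD ih).congr fun _ _ => curv_succ α m _

theorem spd_smul_arcD (hp : p ∈ domain) : spd α p • arcD α F p = partialU F p := by
  rw [arcD_def, smul_smul, mul_inv_cancel₀ (h.spd_pos hp).ne', one_smul]

theorem hasDerivWithinAt_arcD (hF : ContDiffOn ℝ ∞ F domain) (hp : p ∈ domain) :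
    HasDerivWithinAt (fun v => F (v, p.2)) (spd α p • arcD α F p) I p.1 := by
  rw [h.spd_smul_arcD hp]
  exact hasDerivWithinAt_partialU hF hp

theorem arcD_unique {y : E} (hp : p ∈ domain)
    (hy : HasDerivWithinAt (fun v => F (v, p.2)) (spd α p • y) I p.1) : arcD α F p = y := by
  rw [arcD_def, partialU_unique hp hy, smul_smul, inv_mul_cancel₀ (h.spd_pos hp).ne', one_smul]

omit h in
theorem arcD_congr (hFG : EqOn F G domain) (hp : p ∈ domain) : arcD α F p = arcD α G p := by
  rw [arcD_def, arcD_def, partialU_congr hFG hp]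

theorem arcD_add (hF : ContDiffOn ℝ ∞ F domain) (hG : ContDiffOn ℝ ∞ G domain) (hp : p ∈ domain) :
    arcD α (fun q => F q + G q) p = arcD α F p + arcD α G p :=
  h.arcD_unique hp (((h.hasDerivWithinAt_arcD hF hp).add (h.hasDerivWithinAt_arcD hG hp)).congr_deriv
    (smul_add _ _ _).symm)

theorem arcD_sub (hF : ContDiffOn ℝ ∞ F domain) (hG : ContDiffOn ℝ ∞ G domain) (hp : p ∈ domain) :
    arcD α (fun q => F q - G q) p = arcD α F p - arcD α G p :=
  h.arcD_unique hp (((h.hasDerivWithinAt_arcD hF hp).sub (h.hasDerivWithinAt_arcD hG hp)).congr_deriv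
    (smul_sub _ _ _).symm)

theorem arcD_const_mul (a : ℝ) (hf : ContDiffOn ℝ ∞ f domain) (hp : p ∈ domain) :
    arcD α (fun q => a * f q) p = a * arcD α f p :=
  h.arcD_unique hp (((h.hasDerivWithinAt_arcD hf hp).const_mul a).congr_deriv
    (by simp only [smul_eq_mul]; ring))

theorem arcD_smul (hf : ContDiffOn ℝ ∞ f domain) (hF : ContDiffOn ℝ ∞ F domain) (hp : p ∈ domain) :
    arcD α (fun q => f q • F q) p = f p • arcD α F p + arcD α f p • F p :=
  h.arcD_unique hp (((h.hasDerivWithinAt_arcD hf hp).smul (h.hasDerivWithinAt_arcD hF hp)).congr_deriv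
    (by simp only [smul_eq_mul]; module))

theorem arcD_mul (hf : ContDiffOn ℝ ∞ f domain) (hg : ContDiffOn ℝ ∞ g domain) (hp : p ∈ domain) :
    arcD α (fun q => f q * g q) p = arcD α f p * g p + f p * arcD α g p :=
  h.arcD_unique hp (((h.hasDerivWithinAt_arcD hf hp).mul (h.hasDerivWithinAt_arcD hg hp)).congr_deriv
    (by simp only [smul_eq_mul]; ring))

theorem arcD_inner (hX : ContDiffOn ℝ ∞ X domain) (hY : ContDiffOn ℝ ∞ Y domain)
    (hp : p ∈ domain) :
    arcD α (fun q => inner ℝ (X q) (Y q)) p =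
      inner ℝ (arcD α X p) (Y p) + inner ℝ (X p) (arcD α Y p) :=
  h.arcD_unique hp (((h.hasDerivWithinAt_arcD hX hp).inner ℝ
    (h.hasDerivWithinAt_arcD hY hp)).congr_deriv
    (by simp only [inner_smul_left, inner_smul_right, smul_eq_mul, conj_trivial]; ring))

theorem inner_tan_tan (hp : p ∈ domain) : inner ℝ (tan α p) (tan α p) = 1 := by
  have hv := (h.spd_pos hp).ne'
  rw [tan_eq, arcD_def, real_inner_self_eq_norm_sq, norm_smul, ← spd_eq, norm_inv, Real.norm_eq_abs,
    abs_of_pos (h.spd_pos hp), inv_mul_cancel₀ hv, one_pow]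

theorem inner_nor_nor (hp : p ∈ domain) : inner ℝ (nor α p) (nor α p) = 1 := by
  rw [nor_eq, inner_rotate_rotate, h.inner_tan_tan hp]

omit h in
theorem inner_tan_nor : inner ℝ (tan α p) (nor α p) = 0 := inner_rotate_self _

omit h in
theorem inner_nor_tan : inner ℝ (nor α p) (tan α p) = 0 := by
  rw [real_inner_comm]; exact inner_rotate_self _

/-- Frenet equation: `τ_s` has no tangential part because `|τ| = 1`, and the minus sign is the
convention `k = -⟨τ_s, ν⟩`. -/
theorem arcD_tan (hp : p ∈ domain) : arcD α (tan α) p = -(curv α 0 p • nor α p) := by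
  have h1 : arcD α (fun q => inner ℝ (tan α q) (tan α q)) p = 0 := by
    rw [arcD_congr (G := fun _ => (1 : ℝ)) (fun q hq => h.inner_tan_tan hq) hp]
    exact h.arcD_unique hp (by simpa using hasDerivWithinAt_const _ _ _)
  rw [h.arcD_inner h.smooth_tan h.smooth_tan hp, real_inner_comm] at h1
  have h2 := plane_decomposition (h.inner_tan_tan hp) (arcD α (tan α) p)
  rw [← nor_eq] at h2
  have h3 : inner ℝ (arcD α (tan α) p) (tan α p) = 0 := by
    rw [real_inner_comm]; linarith
  rw [h2, h3, curv_zero]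
  simp

theorem arcD_nor (hp : p ∈ domain) : arcD α (nor α) p = curv α 0 p • tan α p := by
  have h1 : HasDerivWithinAt (fun v => nor α (v, p.2))
      (rotateL (spd α p • arcD α (tan α) p)) I p.1 :=
    rotateL.hasFDerivAt.comp_hasDerivWithinAt p.1 (h.hasDerivWithinAt_arcD h.smooth_tan hp)
  apply h.arcD_unique hp
  refine h1.congr_deriv ?_
  rw [map_smul, h.arcD_tan hp, map_neg, map_smul, rotateL_apply, nor_eq, rotate_rotate]
  simp

end IsRegularFamily

/-! ### Evolution equations -/

/-- A smooth family of regular curves that moves by curve diffusion. -/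
structure IsFlow (α : ℝ → ℝ → Plane) : Prop extends IsRegularFamily α where
  flow : ∀ p ∈ domain, partialT (pos α) p = curv α 2 p • nor α p

theorem IsGlobalSolution.isFlow {θ₁ θ₂ : ℝ} {α₀ : ℝ → Plane} {α : ℝ → ℝ → Plane}
    (h : IsGlobalSolution θ₁ θ₂ α₀ α) : IsFlow α where
  smooth := h.smooth
  regular p hp := h.regular p.2 hp.2 p.1 hp.1
  flow p hp := partialT_unique hp (h.flow p.2 hp.2 p.1 hp.1)

namespace IsFlow

variable {α : ℝ → ℝ → Plane} (h : IsFlow α) {p : ℝ × ℝ}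

include h

/-- Commuting derivatives gives `∂_u (k_ss ν)`. Its tangential part `k k_ss` is the stretching rate
of arclength, its normal part `k_sss` the turning rate of the tangent. -/
theorem partialT_partialU_pos (hp : p ∈ domain) : partialT (partialU (pos α)) p =
    spd α p • (curv α 3 p • nor α p + (curv α 0 p * curv α 2 p) • tan α p) := by
  have hr := h.toIsRegularFamily
  rw [partialT_partialU h.smooth hp, partialU_congr h.flow hp, ← hr.spd_smul_arcD hp,
    hr.arcD_smul (hr.smooth_curv 2) hr.smooth_nor hp, hr.arcD_nor hp, ← curv_succ]
  module

end IsFlow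


/-! ### Cubic remainder terms in the curvature derivatives -/

/-- Linear combinations of products of three derivatives of the curvature of total order `n`. -/
def cubic (α : ℝ → ℝ → Plane) (n : ℕ) : Submodule ℝ (ℝ × ℝ → ℝ) :=
  Submodule.span ℝ {f | ∃ a b c, a + b + c = n ∧ f = fun p => curv α a p * curv α b p * curv α c p}

theorem mem_cubic (α : ℝ → ℝ → Plane) (a b c : ℕ) :
    (fun p => curv α a p * curv α b p * curv α c p) ∈ cubic α (a + b + c) :=
  Submodule.subset_span ⟨a, b, c, rfl, rfl⟩

/-- Induction principle for cubic expressions, stated for pointwise operations. -/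
theorem cubic_induction {α : ℝ → ℝ → Plane} {n : ℕ} {P : (ℝ × ℝ → ℝ) → Prop}
    (monomial : ∀ a b c, a + b + c = n → P fun p => curv α a p * curv α b p * curv α c p)
    (zero : P fun _ => 0) (add : ∀ f g, P f → P g → P fun p => f p + g p)
    (smul : ∀ (a : ℝ) f, P f → P fun p => a * f p) {f : ℝ × ℝ → ℝ} (hf : f ∈ cubic α n) : P f := by
  induction hf using Submodule.span_induction with
  | mem f hf => obtain ⟨a, b, c, hn, rfl⟩ := hf; exact monomial a b c hn
  | zero => exact zero
  | add f g _ _ hf hg => exact add f g hf hg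
  | smul a f _ hf => exact smul a f hf

theorem curv_succ_funext (α : ℝ → ℝ → Plane) (m : ℕ) : curv α (m + 1) = arcD α (curv α m) :=
  funext fun p => curv_succ α m p

namespace IsRegularFamily

variable {α : ℝ → ℝ → Plane} (h : IsRegularFamily α) {f : ℝ × ℝ → ℝ} {n : ℕ}

include h

theorem smooth_of_mem_cubic (hf : f ∈ cubic α n) : ContDiffOn ℝ ∞ f domain := by
  refine cubic_induction (P := fun f => ContDiffOn ℝ ∞ f domain) (fun a b c _ => ?_)
    contDiffOn_const (fun f g hf hg => hf.add hg)
    (fun a f hf => contDiffOn_const.mul hf) hf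
  exact ((h.smooth_curv a).mul (h.smooth_curv b)).mul (h.smooth_curv c)

theorem exists_arcD_mem_cubic (hf : f ∈ cubic α n) :
    ∃ g ∈ cubic α (n + 1), EqOn (arcD α f) g domain := by
  -- Smoothness travels through the induction because the sum and scaling rules for `arcD` need it.
  suffices H : ContDiffOn ℝ ∞ f domain ∧ ∃ g ∈ cubic α (n + 1), EqOn (arcD α f) g domain from H.2
  refine cubic_induction (P := fun f => ContDiffOn ℝ ∞ f domain ∧
    ∃ g ∈ cubic α (n + 1), EqOn (arcD α f) g domain)
    (fun a b c hn => ?_) ?_ (fun f₁ f₂ h₁ h₂ => ?_) (fun a f₁ h₁ => ?_) hf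
  · have ha := h.smooth_curv a
    have hb := h.smooth_curv b
    have hc := h.smooth_curv c
    refine ⟨(ha.mul hb).mul hc, _, Submodule.add_mem _ (Submodule.add_mem _
      (Submodule.subset_span ⟨a + 1, b, c, by omega, rfl⟩)
      (Submodule.subset_span ⟨a, b + 1, c, by omega, rfl⟩))
      (Submodule.subset_span ⟨a, b, c + 1, by omega, rfl⟩), fun p hp => ?_⟩
    rw [h.arcD_mul (ha.mul hb) hc hp, h.arcD_mul ha hb hp]
    simp only [Pi.add_apply, curv_succ]
    ring
  · refine ⟨contDiffOn_const, 0, Submodule.zero_mem _, fun p hp => ?_⟩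
    exact h.arcD_unique hp (by simpa using hasDerivWithinAt_const _ _ _)
  · obtain ⟨s₁, g₁, hg₁, e₁⟩ := h₁
    obtain ⟨s₂, g₂, hg₂, e₂⟩ := h₂
    refine ⟨s₁.add s₂, g₁ + g₂, Submodule.add_mem _ hg₁ hg₂, fun p hp => ?_⟩
    rw [h.arcD_add s₁ s₂ hp, e₁ hp, e₂ hp, Pi.add_apply]
  · obtain ⟨s₁, g₁, hg₁, e₁⟩ := h₁
    refine ⟨contDiffOn_const.mul s₁, a • g₁, Submodule.smul_mem _ _ hg₁, fun p hp => ?_⟩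
    rw [h.arcD_const_mul a s₁ hp, e₁ hp, Pi.smul_apply, smul_eq_mul]

end IsRegularFamily

namespace IsFlow

variable {α : ℝ → ℝ → Plane} (h : IsFlow α)
  {E : Type} [NormedAddCommGroup E] [NormedSpace ℝ E] {G : ℝ × ℝ → E} {f : ℝ × ℝ → ℝ} {p : ℝ × ℝ}

include h

theorem partialT_spd (hp : p ∈ domain) :
    partialT (spd α) p = spd α p * (curv α 0 p * curv α 2 p) := by
  have hr := h.toIsRegularFamily
  have hv := hr.spd_pos hp
  have h1 := hasDerivWithinAt_partialT hr.smooth_spd hp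
  have h2 := hasDerivWithinAt_partialT (smooth_partialU h.smooth) hp
  have h3 := h2.inner ℝ h2
  have e : ∀ q : ℝ × ℝ, inner ℝ (partialU (pos α) q) (partialU (pos α) q) = spd α q * spd α q := by
    intro q
    rw [spd_eq, real_inner_self_eq_norm_mul_norm]
  simp only [e] at h3
  have h4 := (uniqueDiffOn_Ici (0 : ℝ) p.2 hp.2).eq_deriv _ (h1.mul h1) h3
  rw [Prod.mk.eta, h.partialT_partialU_pos hp, ← hr.spd_smul_arcD hp, ← tan_eq] at h4
  simp only [inner_smul_left, inner_smul_right, inner_add_left, inner_add_right,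
    IsRegularFamily.inner_tan_nor, IsRegularFamily.inner_nor_tan, hr.inner_tan_tan hp,
    conj_trivial] at h4
  have h5 : spd α p * (partialT (spd α) p - spd α p * (curv α 0 p * curv α 2 p)) = 0 := by
    linear_combination h4 / 2
  rcases mul_eq_zero.1 h5 with h6 | h6
  · exact absurd h6 hv.ne'
  · linarith

/-- The commutator `[∂_t, ∂_s] = -k k_ss ∂_s`, read off from the time derivative of `spd • arcD =
partialU`. -/
theorem partialT_arcD (hG : ContDiffOn ℝ ∞ G domain) (hp : p ∈ domain) :
    partialT (arcD α G) p = arcD α (partialT G) p - (curv α 0 p * curv α 2 p) • arcD α G p := by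
  have hr := h.toIsRegularFamily
  have hv := (hr.spd_pos hp).ne'
  have h1 := hasDerivWithinAt_partialT hr.smooth_spd hp
  have h2 := hasDerivWithinAt_partialT (hr.smooth_arcD hG) hp
  have h3 := partialT_unique (F := fun q => spd α q • arcD α G q) hp (h1.smul h2)
  rw [partialT_congr (fun q hq => hr.spd_smul_arcD (F := G) hq) hp, partialT_partialU hG hp,
    ← hr.spd_smul_arcD hp, h.partialT_spd hp] at h3
  have h4 : spd α p • (partialT (arcD α G) p -
      (arcD α (partialT G) p - (curv α 0 p * curv α 2 p) • arcD α G p)) = 0 := by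
    simp only [Prod.mk.eta] at h3
    rw [smul_sub, smul_sub, h3]
    module
  exact sub_eq_zero.1 ((smul_eq_zero.1 h4).resolve_left hv)

theorem partialT_tan (hp : p ∈ domain) : partialT (tan α) p = curv α 3 p • nor α p := by
  have hr := h.toIsRegularFamily
  have e : tan α = arcD α (pos α) := rfl
  rw [e, h.partialT_arcD h.smooth hp, IsRegularFamily.arcD_congr h.flow hp,
    hr.arcD_smul (hr.smooth_curv 2) hr.smooth_nor hp, hr.arcD_nor hp, ← curv_succ, ← tan_eq]
  module

theorem partialT_nor (hp : p ∈ domain) : partialT (nor α) p = -(curv α 3 p • tan α p) := by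
  have h1 : HasDerivWithinAt (fun r => nor α (p.1, r)) (rotateL (partialT (tan α) p)) (Ici 0) p.2 :=
    rotateL.hasFDerivAt.comp_hasDerivWithinAt p.2
      (hasDerivWithinAt_partialT h.toIsRegularFamily.smooth_tan hp)
  rw [partialT_unique hp h1, h.partialT_tan hp, map_smul, rotateL_apply, nor_eq, rotate_rotate]
  simp

theorem partialT_curv_zero (hp : p ∈ domain) :
    partialT (curv α 0) p = -curv α 4 p - curv α 0 p * curv α 0 p * curv α 2 p := by
  have hr := h.toIsRegularFamily
  have h1 := hasDerivWithinAt_partialT (hr.smooth_arcD hr.smooth_tan) hp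
  have h2 := hasDerivWithinAt_partialT hr.smooth_nor hp
  have h3 := partialT_unique (F := curv α 0) hp (h1.inner ℝ h2).neg
  rw [h3, h.partialT_arcD hr.smooth_tan hp, IsRegularFamily.arcD_congr (fun q => h.partialT_tan) hp,
    hr.arcD_smul (hr.smooth_curv 3) hr.smooth_nor hp, hr.arcD_nor hp, ← curv_succ, Prod.mk.eta,
    h.partialT_nor hp, hr.arcD_tan hp]
  simp only [inner_smul_left, inner_smul_right, inner_add_left, inner_sub_left, inner_neg_left,
    inner_neg_right, IsRegularFamily.inner_tan_nor, IsRegularFamily.inner_nor_tan,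
    hr.inner_nor_nor hp, conj_trivial]
  ring

/-- Each further `∂_s` raises the order of the remainder by one, and the commutator contributes `k
k_ss k_{m+1}`, again cubic of order `m + 3`. Only the total order matters later: its parity at the
boundary, its size in the interpolation. -/
theorem partialT_curv (m : ℕ) :
    ∃ f ∈ cubic α (m + 2), ∀ p ∈ domain, partialT (curv α m) p = -curv α (m + 4) p + f p := by
  have hr := h.toIsRegularFamily
  induction m with
  | zero =>
    refine ⟨_, Submodule.neg_mem _ (mem_cubic α 0 0 2), fun p hp => ?_⟩
    rw [h.partialT_curv_zero hp, Pi.neg_apply]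
    ring
  | succ m ih =>
    obtain ⟨f, hf, ef⟩ := ih
    obtain ⟨g, hg, eg⟩ := hr.exists_arcD_mem_cubic hf
    refine ⟨_, Submodule.sub_mem _ hg
      (Submodule.subset_span ⟨0, 2, m + 1, by omega, rfl⟩), fun p hp => ?_⟩
    have ef' : EqOn (partialT (curv α m)) (fun q => f q - curv α (m + 4) q) domain :=
      fun q hq => by rw [ef q hq]; ring
    rw [curv_succ_funext, h.partialT_arcD (hr.smooth_curv m) hp,
      IsRegularFamily.arcD_congr ef' hp,
      hr.arcD_sub (hr.smooth_of_mem_cubic hf) (hr.smooth_curv (m + 4)) hp, eg hp, ← curv_succ,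
      ← curv_succ_funext, Pi.sub_apply, smul_eq_mul]
    ring_nf

/-! ### Boundary behaviour -/

omit h in
theorem partialT_eq_zero_of_forall {u : ℝ} (hu : u ∈ I) (h0 : ∀ t, 0 ≤ t → f (u, t) = 0) {t : ℝ}
    (ht : 0 ≤ t) : partialT f (u, t) = 0 := by
  refine partialT_unique ⟨hu, ht⟩ ?_
  exact (hasDerivWithinAt_const t (Ici 0) (0 : ℝ)).congr (fun r hr => h0 r hr) (h0 t ht)

/-- All odd arclength derivatives of the curvature vanish at an endpoint where the first one does
and where the curve meets a fixed line perpendicularly. -/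
theorem curv_odd_eq_zero {u : ℝ} (hu : u ∈ I) (w : Plane) (hw : w ≠ 0)
    (h1 : ∀ t, 0 ≤ t → curv α 1 (u, t) = 0) (hn : ∀ t, 0 ≤ t → inner ℝ (nor α (u, t)) w = 0)
    (n : ℕ) : ∀ t, 0 ≤ t → curv α (2 * n + 1) (u, t) = 0 := by
  have hr := h.toIsRegularFamily
  -- As `ν_t = -k_sss τ`, differentiating `⟨ν, w⟩ = 0` in time gives `k_sss ⟨τ, w⟩ = 0`; and `⟨τ, w⟩
  -- ≠ 0`, since `w ≠ 0` is orthogonal to `ν`.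
  have h3 : ∀ t, 0 ≤ t → curv α 3 (u, t) = 0 := by
    intro t ht
    have hp : (u, t) ∈ domain := ⟨hu, ht⟩
    have d := (hasDerivWithinAt_partialT hr.smooth_nor hp).inner ℝ
      (hasDerivWithinAt_const t (Ici 0) w)
    have d0 := partialT_unique (F := fun q => inner ℝ (nor α q) w) hp d
    rw [partialT_eq_zero_of_forall hu hn ht, h.partialT_nor hp] at d0
    simp only [inner_zero_right, zero_add, inner_neg_left, inner_smul_left, conj_trivial] at d0
    have d1 : curv α 3 (u, t) * inner ℝ (tan α (u, t)) w = 0 := by linarith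
    refine (mul_eq_zero.1 d1).resolve_right fun d2 => hw ?_
    have d3 := plane_decomposition (hr.inner_tan_tan hp) w
    rw [← nor_eq, real_inner_comm, d2, real_inner_comm, hn t ht] at d3
    simpa using d3
  induction n using Nat.strong_induction_on with
  | _ n ih =>
    match n, ih with
    | 0, _ => exact h1
    | 1, _ => exact h3
    | n + 2, ih =>
      intro t ht
      obtain ⟨f, hf, ef⟩ := h.partialT_curv (2 * n + 1)
      have e := ef (u, t) ⟨hu, ht⟩
      -- The total order `2n + 3` is odd, so each monomial has a factor of odd order at most `2n +
      -- 3`, which vanishes by induction. The evolution equation for `k_{2n+1}` then yields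
      -- `k_{2n+5} = 0`; the step by four in the order is why two base cases are needed.
      have hf0 : f (u, t) = 0 := by
        refine cubic_induction (P := fun f => f (u, t) = 0) (fun a b c hn => ?_) rfl
          (fun f g hf hg => by simp only; rw [hf, hg, add_zero])
          (fun a f hf => by simp only; rw [hf, mul_zero]) hf
        have odd : ∀ a, a % 2 = 1 → a ≤ 2 * n + 3 → curv α a (u, t) = 0 := by
          intro a ha hle
          have := ih (a / 2) (by omega) t ht
          rwa [show 2 * (a / 2) + 1 = a by omega] at this
        by_cases ha : a % 2 = 1
        · simp only; rw [odd a ha (by omega)]; ring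
        by_cases hb : b % 2 = 1
        · simp only; rw [odd b hb (by omega)]; ring
        · simp only; rw [odd c (by omega) (by omega)]; ring
      rw [partialT_eq_zero_of_forall hu (ih n (by omega)) ht, hf0] at e
      rw [show 2 * (n + 2) + 1 = 2 * n + 1 + 4 by ring]
      linarith

end IsFlow


/-! ### Decay of the oscillation of curvature -/

section fixedTime

variable {v k k₁ k₂ : ℝ → ℝ}

theorem osc_eq (hv : ContinuousOn v I) (hk : ContinuousOn k I) (c : ℝ) :
    ∫ u in (-1 : ℝ)..1, (k u - c) ^ 2 * v u =
      (∫ u in (-1 : ℝ)..1, k u ^ 2 * v u) - 2 * c * (∫ u in (-1 : ℝ)..1, k u * v u) +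
        c ^ 2 * ∫ u in (-1 : ℝ)..1, v u := by
  have e : ∫ u in (-1 : ℝ)..1, (k u - c) ^ 2 * v u = ∫ u in (-1 : ℝ)..1,
      (1 * (1 * (k u ^ 2 * v u) + (-2 * c) * (k u * v u)) + c ^ 2 * v u) := by
    congr 1; ext u; ring
  rw [e, integral_lincomb_I (by fun_prop) (by fun_prop) left_mem_I right_mem_I,
    integral_lincomb_I (by fun_prop) (by fun_prop) left_mem_I right_mem_I]
  ring

/-- The left side is `L' ‖k‖² + L (‖k‖²)'`, the time derivative of the oscillation `K`. All terms
are compared with `L ‖k_ss‖²`, using that `k_s` vanishes at both ends. -/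
theorem osc_deriv_nonpos (hk : HasArcDeriv v k k₁) (hk₁ : HasArcDeriv v k₁ k₂)
    (hv : ContinuousOn v I) (hv0 : ∀ u ∈ I, 0 ≤ v u) (hL : 0 < ∫ u in (-1 : ℝ)..1, v u)
    (h1 : k₁ (-1) = 0) (h2 : k₁ 1 = 0) {w K : ℝ} (hw : 0 ≤ w)
    (hW : ∫ u in (-1 : ℝ)..1, k u * v u = 2 * Real.pi * w)
    (hK : (∫ u in (-1 : ℝ)..1, v u) * (∫ u in (-1 : ℝ)..1, k u ^ 2 * v u) - (2 * Real.pi * w) ^ 2 = K)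
    (hsmall : 3 / 4 * K + 6 * w * √K ≤ 2 * (1 - 4 * w ^ 2)) :
    (-∫ u in (-1 : ℝ)..1, k₁ u ^ 2 * v u) * (∫ u in (-1 : ℝ)..1, k u ^ 2 * v u) +
      (∫ u in (-1 : ℝ)..1, v u) * (-2 * (∫ u in (-1 : ℝ)..1, k₂ u ^ 2 * v u) +
        3 * ∫ u in (-1 : ℝ)..1, k u ^ 2 * k₁ u ^ 2 * v u) ≤ 0 := by
  have hpi := Real.pi_pos
  have ck := hk.continuousOn
  have ck₁ := hk.cont
  have ck₂ := hk₁.cont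
  have hwirt := wirtinger hk₁ hv hv0 hL h1 h2
  have hsup := fun {u} hu => sq_le_of_dirichlet hk₁ hv hv0 h1 h2 (u := u) hu
  set L := ∫ u in (-1 : ℝ)..1, v u
  set P := ∫ u in (-1 : ℝ)..1, k u ^ 2 * v u with hP
  set a := ∫ u in (-1 : ℝ)..1, k₁ u ^ 2 * v u
  set b := ∫ u in (-1 : ℝ)..1, k₂ u ^ 2 * v u
  have hb : 0 ≤ b := integral_nonneg_I (fun u hu => mul_nonneg (sq_nonneg _) (hv0 u hu))
    left_mem_I right_mem_I (by norm_num)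
  have ha : 0 ≤ a := integral_nonneg_I (fun u hu => mul_nonneg (sq_nonneg _) (hv0 u hu))
    left_mem_I right_mem_I (by norm_num)
  -- The mean curvature.
  set c := 2 * Real.pi * w / L with hc
  have hcL : c * L = 2 * Real.pi * w := div_mul_cancel₀ _ hL.ne'
  set Q := ∫ u in (-1 : ℝ)..1, (k u - c) ^ 2 * v u with hQ
  have hQ0 : 0 ≤ Q := integral_nonneg_I (fun u hu => mul_nonneg (sq_nonneg _) (hv0 u hu))
    left_mem_I right_mem_I (by norm_num)
  have hLQ : L * Q = K := by
    rw [hQ, osc_eq hv ck, hW, ← hK, ← hcL]; ring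
  have hK0 : 0 ≤ K := by rw [← hLQ]; positivity
  set J₂ := ∫ u in (-1 : ℝ)..1, ((k u - c) * k₁ u) ^ 2 * v u with hJ₂
  set J₁ := ∫ u in (-1 : ℝ)..1, (k u - c) * k₁ u * k₁ u * v u with hJ₁
  have e : ∫ u in (-1 : ℝ)..1, k u ^ 2 * k₁ u ^ 2 * v u = J₂ + 2 * c * J₁ + c ^ 2 * a := by
    have e' : ∫ u in (-1 : ℝ)..1, k u ^ 2 * k₁ u ^ 2 * v u = ∫ u in (-1 : ℝ)..1,
        (1 * (1 * (((k u - c) * k₁ u) ^ 2 * v u) + (2 * c) * ((k u - c) * k₁ u * k₁ u * v u)) +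
          c ^ 2 * (k₁ u ^ 2 * v u)) := by
      congr 1; ext u; ring
    rw [e', integral_lincomb_I (by fun_prop) (by fun_prop) left_mem_I right_mem_I,
      integral_lincomb_I (by fun_prop) (by fun_prop) left_mem_I right_mem_I]
    ring
  -- Take `k_s²` out in the sup norm, using the Dirichlet bound `L/4 ‖k_ss‖²`.
  have bJ₂ : J₂ ≤ b * K / 4 := by
    have : J₂ ≤ ∫ u in (-1 : ℝ)..1, (L / 4 * b) * ((k u - c) ^ 2 * v u) := by
      refine integral_mono_I (by fun_prop) (by fun_prop) fun u hu => ?_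
      have := mul_le_mul_of_nonneg_left (hsup hu) (mul_nonneg (sq_nonneg (k u - c)) (hv0 u hu))
      calc ((k u - c) * k₁ u) ^ 2 * v u = (k u - c) ^ 2 * v u * k₁ u ^ 2 := by ring
        _ ≤ _ := this
        _ = _ := by ring
    rw [intervalIntegral.integral_const_mul, ← hQ] at this
    calc J₂ ≤ _ := this
      _ = b * (L * Q) / 4 := by ring
      _ = _ := by rw [hLQ]
  -- Cauchy–Schwarz gives `J₁² ≤ J₂ ‖k_s‖²`, and Wirtinger bounds `‖k_s‖²` by `(L/π)² ‖k_ss‖²`.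
  have bJ₁ : J₁ ≤ b * L * √K / (2 * Real.pi) := by
    apply le_of_sq_le_sq _ (by positivity)
    have cs := cauchy_schwarz (f := fun u => (k u - c) * k₁ u) hv hv0 (by fun_prop) ck₁
      left_mem_I right_mem_I (by norm_num)
    calc J₁ ^ 2 ≤ J₂ * a := cs
      _ ≤ (b * K / 4) * ((L / Real.pi) ^ 2 * b) := mul_le_mul bJ₂ hwirt ha (by positivity)
      _ = (b * L * √K / (2 * Real.pi)) ^ 2 := by
        have hs := Real.sq_sqrt hK0
        field_simp
        rw [hs]
        ring
  have hLP : L * P = K + (2 * Real.pi * w) ^ 2 := by linarith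
  rw [e]
  have h3 : a * P = a * (K + (2 * Real.pi * w) ^ 2) / L := by
    rw [← hLP]; field_simp
  have h4 : L * c ^ 2 * a = (2 * Real.pi * w) ^ 2 * a / L := by
    rw [hc]; field_simp
  have h5 : a / L ≤ L * b / Real.pi ^ 2 := by
    rw [div_le_iff₀ hL]
    calc a ≤ _ := hwirt
      _ = _ := by rw [div_pow]; ring
  have h6 : (2 * Real.pi * w) ^ 2 * (a / L) ≤ 4 * w ^ 2 * (L * b) := by
    calc _ ≤ (2 * Real.pi * w) ^ 2 * (L * b / Real.pi ^ 2) := by gcongr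
      _ = _ := by field_simp; ring
  have h7 : (2 * Real.pi * w) * J₁ ≤ w * √K * (L * b) := by
    calc _ ≤ (2 * Real.pi * w) * (b * L * √K / (2 * Real.pi)) := by gcongr
      _ = _ := by field_simp
  have h8 : 0 ≤ a * K / L := by positivity
  have h9 : (3 / 4 * K + 6 * w * √K) * (L * b) ≤ 2 * (1 - 4 * w ^ 2) * (L * b) := by gcongr
  have h10 : L * J₂ ≤ L * (b * K / 4) := by gcongr
  calc _ = -(a * P) + -2 * (L * b) + 3 * (L * J₂) + 6 * ((c * L) * J₁) + 3 * (L * c ^ 2 * a) := by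
        ring
    _ = -(a * K / L) + 2 * ((2 * Real.pi * w) ^ 2 * (a / L)) + -2 * (L * b) + 3 * (L * J₂) +
        6 * ((2 * Real.pi * w) * J₁) := by
      rw [hcL, h3, h4]; ring
    _ ≤ 0 := by nlinarith

end fixedTime

/-- A continuous function that decreases while it is below a barrier stays below its initial
bound if that bound lies below the barrier. -/
theorem le_of_deriv_nonpos_below {f f' : ℝ → ℝ} {B B' : ℝ} (hf : ContinuousOn f (Ici 0))
    (hf' : ∀ t, 0 < t → HasDerivAt f (f' t) t) (hB : B < B') (h0 : f 0 ≤ B)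
    (h : ∀ t, 0 < t → f t ≤ B' → f' t ≤ 0) {t : ℝ} (ht : 0 ≤ t) : f t ≤ B := by
  have key : Icc 0 t ⊆ {s | f s ≤ B} := by
    apply IsClosed.Icc_subset_of_forall_mem_nhdsWithin
    · have : ContinuousOn f (Icc 0 t) := hf.mono Icc_subset_Ici_self
      have := this.preimage_isClosed_of_isClosed isClosed_Icc (isClosed_Iic (a := B))
      rwa [inter_comm] at this
    · exact h0
    · rintro x ⟨hx, hx0, -⟩
      -- The gap between `B` and `B'` keeps `f` below the barrier for a short time after `x`, where
      -- it therefore decreases.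
      have hev : ∀ᶠ y in nhdsWithin x (Ici 0), f y < B' :=
        (hf x hx0).eventually (Iio_mem_nhds (lt_of_le_of_lt hx hB))
      obtain ⟨δ, hδ, hball⟩ := Metric.mem_nhdsWithin_iff.1 hev
      filter_upwards [Ioo_mem_nhdsGT (show x < x + δ by linarith)] with y hy
      have hanti : AntitoneOn f (Icc x y) := by
        apply antitoneOn_of_deriv_nonpos (convex_Icc x y)
          (hf.mono fun z hz => le_trans hx0 hz.1)
        · intro z hz
          rw [interior_Icc] at hz
          exact (hf' z (lt_of_le_of_lt hx0 hz.1)).differentiableAt.differentiableWithinAt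
        · intro z hz
          rw [interior_Icc] at hz
          have hz0 : 0 < z := lt_of_le_of_lt hx0 hz.1
          rw [(hf' z hz0).deriv]
          refine h z hz0 (le_of_lt (hball ⟨?_, hz0.le⟩))
          rw [Metric.mem_ball, Real.dist_eq, abs_of_pos (by linarith [hz.1])]
          linarith [hz.2, hy.2]
      exact le_trans (hanti ⟨le_rfl, hy.1.le⟩ ⟨hy.1.le, le_rfl⟩ hy.1.le) hx
  exact key ⟨ht, le_rfl⟩

/-- A continuous function that decreases while it is above `B` stays bounded. -/
theorem le_of_deriv_nonpos_above {f f' : ℝ → ℝ} {B : ℝ} (hf : ContinuousOn f (Ici 0))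
    (hf' : ∀ t, 0 < t → HasDerivAt f (f' t) t) (h0 : f 0 ≤ B)
    (h : ∀ t, 0 < t → B < f t → f' t ≤ 0) {t : ℝ} (ht : 0 ≤ t) : f t ≤ B := by
  by_contra! hlt
  -- After the last time in `S`, `f` exceeds `B` and hence decreases, so it cannot have risen above
  -- `B` at `t`.
  set S := Icc 0 t ∩ {s | f s ≤ B}
  have hS : IsClosed S := by
    have : ContinuousOn f (Icc 0 t) := hf.mono Icc_subset_Ici_self
    exact this.preimage_isClosed_of_isClosed isClosed_Icc (isClosed_Iic (a := B))
  have hSb : BddAbove S := ⟨t, fun s hs => hs.1.2⟩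
  have hSn : S.Nonempty := ⟨0, ⟨le_rfl, ht⟩, h0⟩
  have hx := hS.csSup_mem hSn hSb
  set x := sSup S
  have hanti : AntitoneOn f (Icc x t) := by
    apply antitoneOn_of_deriv_nonpos (convex_Icc x t)
      (hf.mono fun z hz => le_trans hx.1.1 hz.1)
    · intro z hz
      rw [interior_Icc] at hz
      exact (hf' z (lt_of_le_of_lt hx.1.1 hz.1)).differentiableAt.differentiableWithinAt
    · intro z hz
      rw [interior_Icc] at hz
      have hz0 : 0 < z := lt_of_le_of_lt hx.1.1 hz.1
      rw [(hf' z hz0).deriv]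
      refine h z hz0 ?_
      by_contra! hle
      exact absurd (le_csSup hSb ⟨⟨hz0.le, hz.2.le⟩, hle⟩) (not_le.2 hz.1)
  have := hanti ⟨le_rfl, hx.1.2⟩ ⟨hx.1.2, le_rfl⟩ hx.1.2
  exact absurd (le_trans this hx.2) (not_le.2 hlt)

/-! ### Integrals along the flow -/

/-- The integral of a space-time function along the curve at time `t`. -/
def arcInt (α : ℝ → ℝ → Plane) (G : ℝ × ℝ → ℝ) (t : ℝ) : ℝ :=
  ∫ u in (-1 : ℝ)..1, G (u, t) * spd α (u, t)

/-- The length of the curve at time `t`. -/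
def len (α : ℝ → ℝ → Plane) (t : ℝ) : ℝ := ∫ u in (-1 : ℝ)..1, spd α (u, t)

theorem arcInt_one (α : ℝ → ℝ → Plane) (t : ℝ) : arcInt α (fun _ => 1) t = len α t := by
  simp [arcInt, len]

theorem arcInt_congr (α : ℝ → ℝ → Plane) {F G : ℝ × ℝ → ℝ} (hFG : EqOn F G domain) {t : ℝ}
    (ht : 0 ≤ t) : arcInt α F t = arcInt α G t := by
  apply intervalIntegral.integral_congr
  intro u hu
  rw [uIcc_of_le (by norm_num)] at hu
  simp only
  rw [hFG (mk_mem_domain hu ht)]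

namespace IsRegularFamily

variable {α : ℝ → ℝ → Plane} (h : IsRegularFamily α) {G : ℝ × ℝ → ℝ} {t : ℝ}

include h

theorem slice_hasArcDeriv (hG : ContDiffOn ℝ ∞ G domain) (ht : 0 ≤ t) :
    HasArcDeriv (fun u => spd α (u, t)) (fun u => G (u, t)) (fun u => arcD α G (u, t)) where
  deriv u hu := (h.hasDerivWithinAt_arcD hG (mk_mem_domain hu ht)).congr_deriv (mul_comm _ _)
  cont := (h.smooth_arcD hG).continuousOn.comp (by fun_prop) fun _ hu => mk_mem_domain hu ht

theorem slice_hasArcDeriv_curv (m : ℕ) (ht : 0 ≤ t) :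
    HasArcDeriv (fun u => spd α (u, t)) (fun u => curv α m (u, t)) fun u => curv α (m + 1) (u, t) := by
  rw [curv_succ_funext]
  exact h.slice_hasArcDeriv (h.smooth_curv m) ht

theorem slice_spd_continuousOn (ht : 0 ≤ t) : ContinuousOn (fun u => spd α (u, t)) I :=
  h.smooth_spd.continuousOn.comp (by fun_prop) fun _ hu => mk_mem_domain hu ht

theorem slice_spd_pos (ht : 0 ≤ t) : ∀ u ∈ I, 0 < spd α (u, t) :=
  fun _ hu => h.spd_pos (mk_mem_domain hu ht)

theorem slice_spd_nonneg (ht : 0 ≤ t) : ∀ u ∈ I, 0 ≤ spd α (u, t) :=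
  fun u hu => (h.slice_spd_pos ht u hu).le

theorem len_pos (ht : 0 ≤ t) : 0 < len α t := by
  apply intervalIntegral.intervalIntegral_pos_of_pos_on
    (intervalIntegrable_of_continuousOn (h.slice_spd_continuousOn ht) left_mem_I right_mem_I)
  · exact fun u hu => h.slice_spd_pos ht u ⟨hu.1.le, hu.2.le⟩
  · norm_num

theorem continuousOn_arcInt (hG : ContDiffOn ℝ ∞ G domain) : ContinuousOn (arcInt α G) (Ici 0) :=
  continuousOn_integral (hG.mul h.smooth_spd).continuousOn

end IsRegularFamily

/-- A curve diffusion flow for which all odd arclength derivatives of the curvature vanish at the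
endpoints. -/
structure IsNeumannFlow (α : ℝ → ℝ → Plane) : Prop extends IsFlow α where
  odd_left : ∀ n t, 0 ≤ t → curv α (2 * n + 1) (-1, t) = 0
  odd_right : ∀ n t, 0 ≤ t → curv α (2 * n + 1) (1, t) = 0

theorem IsFlow.hasDerivAt_arcInt {α : ℝ → ℝ → Plane} (h : IsFlow α) {G : ℝ × ℝ → ℝ} {t : ℝ}
    (hG : ContDiffOn ℝ ∞ G domain) (ht : 0 < t) :
    HasDerivAt (arcInt α G)
      (arcInt α (fun p => partialT G p + curv α 0 p * curv α 2 p * G p) t) t := by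
  have hr := h.toIsRegularFamily
  refine (hasDerivAt_integral (hG.mul hr.smooth_spd) ht).congr_deriv ?_
  apply intervalIntegral.integral_congr
  intro u hu
  rw [uIcc_of_le (by norm_num)] at hu
  have hp := mk_mem_domain hu ht.le
  have := partialT_unique (F := fun q => G q * spd α q) hp
    ((hasDerivWithinAt_partialT hG hp).mul (hasDerivWithinAt_partialT hr.smooth_spd hp))
  simp only
  rw [this, h.partialT_spd hp]
  ring

namespace IsNeumannFlow

variable {α : ℝ → ℝ → Plane} (h : IsNeumannFlow α) {t : ℝ}

include h

theorem arcInt_curv_even {n : ℕ} (ht : 0 ≤ t) : arcInt α (curv α (2 * n + 2)) t = 0 := by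
  have hr := h.toIsRegularFamily
  have e := (hr.slice_hasArcDeriv_curv (2 * n + 1) ht).integral (hr.slice_spd_continuousOn ht)
  rw [h.odd_left n t ht, h.odd_right n t ht, sub_zero] at e
  exact e

/-- `∫ k_m k_{m+4} ds = ∫ k_{m+2}² ds`. -/
theorem arcInt_curv_mul_curv (m : ℕ) (ht : 0 ≤ t) :
    arcInt α (fun p => curv α m p * curv α (m + 4) p) t =
      arcInt α (fun p => curv α (m + 2) p ^ 2) t := by
  have hr := h.toIsRegularFamily
  have hv := hr.slice_spd_continuousOn ht
  have bd : ∀ i j : ℕ, (i + j) % 2 = 1 →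
      curv α i (1, t) * curv α j (1, t) - curv α i (-1, t) * curv α j (-1, t) = 0 := by
    intro i j hij
    have hodd : ∀ i : ℕ, i % 2 = 1 → curv α i (1, t) = 0 ∧ curv α i (-1, t) = 0 := by
      intro i hi
      have h1 := h.odd_left (i / 2) t ht
      have h2 := h.odd_right (i / 2) t ht
      rw [show 2 * (i / 2) + 1 = i by omega] at h1 h2
      exact ⟨h2, h1⟩
    rcases Nat.mod_two_eq_zero_or_one i with hi | hi
    · rw [(hodd j (by omega)).1, (hodd j (by omega)).2]; ring
    · rw [(hodd i hi).1, (hodd i hi).2]; ring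
  have e1 := (hr.slice_hasArcDeriv_curv m ht).integral_mul (hr.slice_hasArcDeriv_curv (m + 3) ht) hv
  have e2 := (hr.slice_hasArcDeriv_curv (m + 1) ht).integral_mul
    (hr.slice_hasArcDeriv_curv (m + 2) ht) hv
  rw [bd _ _ (by omega), zero_sub] at e1 e2
  rw [arcInt, e1, e2, neg_neg, arcInt]
  simp only [sq]

theorem hasDerivAt_len (ht : 0 < t) :
    HasDerivAt (len α) (-arcInt α (fun p => curv α 1 p ^ 2) t) t := by
  have hr := h.toIsRegularFamily
  have h1 := h.toIsFlow.hasDerivAt_arcInt (G := fun _ => 1) contDiffOn_const ht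
  rw [show arcInt α (fun _ => 1) = len α from funext (arcInt_one α)] at h1
  refine h1.congr_deriv ?_
  have e : EqOn (fun p => partialT (fun _ => (1 : ℝ)) p + curv α 0 p * curv α 2 p * 1)
      (fun p => curv α 0 p * curv α 2 p) domain := by
    intro p hp
    simp only
    rw [partialT_unique (F := fun _ => (1 : ℝ)) hp (hasDerivWithinAt_const _ _ _)]
    ring
  rw [arcInt_congr α e ht.le, arcInt, (hr.slice_hasArcDeriv_curv 0 ht.le).integral_mul
    (hr.slice_hasArcDeriv_curv 1 ht.le) (hr.slice_spd_continuousOn ht.le)]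
  have h2 := h.odd_left 0 t ht.le
  have h3 := h.odd_right 0 t ht.le
  simp only [mul_zero, zero_add] at h2 h3 ⊢
  rw [h2, h3, arcInt]
  simp only [sq, mul_zero, sub_zero, zero_sub]

theorem hasDerivAt_total_curvature (ht : 0 < t) : HasDerivAt (arcInt α (curv α 0)) 0 t := by
  have hr := h.toIsRegularFamily
  refine (h.toIsFlow.hasDerivAt_arcInt (hr.smooth_curv 0) ht).congr_deriv ?_
  -- The change of `ds` cancels the cubic term of `k_t`, leaving the exact derivative `-k_ssss`.
  have e : EqOn (fun p => partialT (curv α 0) p + curv α 0 p * curv α 2 p * curv α 0 p)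
      (fun p => (-1) * curv α 4 p) domain := by
    intro p hp
    simp only
    rw [h.toIsFlow.partialT_curv_zero hp]
    ring
  have h4 := h.arcInt_curv_even (n := 1) ht.le
  rw [arcInt] at h4
  rw [arcInt_congr α e ht.le, arcInt]
  simp only [mul_assoc]
  rw [intervalIntegral.integral_const_mul, h4, mul_zero]

theorem hasDerivAt_energy (ht : 0 < t) :
    HasDerivAt (arcInt α fun p => curv α 0 p ^ 2)
      (-2 * arcInt α (fun p => curv α 2 p ^ 2) t +
        3 * arcInt α (fun p => curv α 0 p ^ 2 * curv α 1 p ^ 2) t) t := by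
  have hr := h.toIsRegularFamily
  have hv := hr.slice_spd_continuousOn ht.le
  refine (h.toIsFlow.hasDerivAt_arcInt ((hr.smooth_curv 0).pow 2) ht).congr_deriv ?_
  have e : EqOn (fun p => partialT (fun p => curv α 0 p ^ 2) p +
        curv α 0 p * curv α 2 p * curv α 0 p ^ 2)
      (fun p => -2 * (curv α 0 p * curv α 4 p) -
        (curv α 0 p * curv α 0 p * curv α 0 p) * curv α 2 p) domain := by
    intro p hp
    have := partialT_unique (F := fun p => curv α 0 p ^ 2) hp
      ((hasDerivWithinAt_partialT (hr.smooth_curv 0) hp).pow 2)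
    simp only
    rw [this, h.toIsFlow.partialT_curv_zero hp]
    simp only [Prod.mk.eta]
    ring
  have c0 := (hr.slice_hasArcDeriv_curv 0 ht.le)
  have c1 := (hr.slice_hasArcDeriv_curv 1 ht.le)
  -- This gives `∫ k³ k_ss = -3 ∫ k² k_s²`, the source of the coefficient `3`.
  have e3 := ((c0.mul c0).mul c0).integral_mul c1 hv
  have h2 := h.odd_left 0 t ht.le
  have h3 := h.odd_right 0 t ht.le
  have k4 := (hr.slice_hasArcDeriv_curv 4 ht.le).continuousOn
  have k0 := c0.continuousOn
  have k1 := c1.continuousOn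
  have k2 := c1.cont
  simp only [mul_zero, zero_add] at h2 h3
  rw [arcInt_congr α e ht.le, arcInt]
  have e4 : ∫ u in (-1 : ℝ)..1, (-2 * (curv α 0 (u, t) * curv α 4 (u, t)) -
        (curv α 0 (u, t) * curv α 0 (u, t) * curv α 0 (u, t)) * curv α 2 (u, t)) * spd α (u, t) =
      ∫ u in (-1 : ℝ)..1, (-2 * (curv α 0 (u, t) * curv α 4 (u, t) * spd α (u, t)) +
        (-1) * (curv α 0 (u, t) * curv α 0 (u, t) * curv α 0 (u, t) * curv α 2 (u, t) *
          spd α (u, t))) := by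
    congr 1; ext u; ring
  rw [e4, integral_lincomb_I (by fun_prop) (by fun_prop) left_mem_I right_mem_I, e3, h2, h3]
  have e5 := h.arcInt_curv_mul_curv 0 ht.le
  simp only [zero_add, arcInt] at e5
  rw [e5]
  simp only [arcInt, mul_zero, sub_zero, zero_sub, neg_mul, one_mul, neg_neg, zero_add]
  congr 1
  rw [← intervalIntegral.integral_const_mul]
  congr 1
  ext u
  ring

theorem total_curvature_eq (ht : 0 ≤ t) : arcInt α (curv α 0) t = arcInt α (curv α 0) 0 := by
  have hr := h.toIsRegularFamily
  have hc := hr.continuousOn_arcInt (hr.smooth_curv 0)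
  apply le_antisymm
  · exact le_of_deriv_nonpos_above hc (fun s hs => h.hasDerivAt_total_curvature hs) le_rfl
      (fun _ _ _ => le_rfl) ht
  · have := le_of_deriv_nonpos_above (f := fun s => -arcInt α (curv α 0) s) hc.neg
      (fun s hs => (h.hasDerivAt_total_curvature hs).neg) le_rfl
      (fun _ _ _ => by simp) ht
    simpa using this

/-- The condition in `osc_deriv_nonpos` is monotone in `K`, so it suffices to check it at the
barrier `B'`. -/
theorem osc_le {w B B' : ℝ} (hw : 0 ≤ w) (hW : arcInt α (curv α 0) 0 = 2 * Real.pi * w)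
    (hBB : B < B') (hB : 3 / 4 * B' + 6 * w * √B' ≤ 2 * (1 - 4 * w ^ 2))
    (h0 : len α 0 * arcInt α (fun p => curv α 0 p ^ 2) 0 - (2 * Real.pi * w) ^ 2 ≤ B) (ht : 0 ≤ t) :
    len α t * arcInt α (fun p => curv α 0 p ^ 2) t - (2 * Real.pi * w) ^ 2 ≤ B := by
  have hr := h.toIsRegularFamily
  have hc1 := hr.continuousOn_arcInt ((hr.smooth_curv 0).pow 2)
  have hc2 := hr.continuousOn_arcInt (G := fun _ => 1) contDiffOn_const
  rw [show arcInt α (fun _ => 1) = len α from funext (arcInt_one α)] at hc2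
  refine le_of_deriv_nonpos_below
    (f := fun t => len α t * arcInt α (fun p => curv α 0 p ^ 2) t - (2 * Real.pi * w) ^ 2)
    ((hc2.mul hc1).sub continuousOn_const)
    (fun s hs => ((h.hasDerivAt_len hs).mul (h.hasDerivAt_energy hs)).sub_const _) hBB h0
    (fun s hs hle => ?_) ht
  have h2 := h.odd_left 0 s hs.le
  have h3 := h.odd_right 0 s hs.le
  simp only [mul_zero, zero_add] at h2 h3
  refine osc_deriv_nonpos (hr.slice_hasArcDeriv_curv 0 hs.le) (hr.slice_hasArcDeriv_curv 1 hs.le)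
    (hr.slice_spd_continuousOn hs.le) (hr.slice_spd_nonneg hs.le) (hr.len_pos hs.le) h2 h3 hw
    (((h.total_curvature_eq hs.le).trans hW)) rfl ?_
  refine le_trans ?_ hB
  simp only [arcInt, len] at hle
  gcongr

end IsNeumannFlow


/-! ### Boundary conditions on the cone -/

theorem norm_eq_one_of_inner_self {x : Plane} (hx : inner ℝ x x = 1) : ‖x‖ = 1 := by
  rw [real_inner_self_eq_norm_sq, sq_eq_one_iff] at hx
  exact hx.resolve_right fun h => by linarith [norm_nonneg x]

theorem polar_zero_coord (ρ θ : ℝ) : polar ρ θ 0 = ρ * Real.cos θ := by simp [polar]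

theorem polar_one_coord (ρ θ : ℝ) : polar ρ θ 1 = ρ * Real.sin θ := by simp [polar]

theorem rayNormal_zero_coord (θ : ℝ) : rayNormal θ 0 = -Real.sin θ := by simp [rayNormal]

theorem rayNormal_one_coord (θ : ℝ) : rayNormal θ 1 = Real.cos θ := by simp [rayNormal]

theorem inner_rayNormal_self (θ : ℝ) : inner ℝ (rayNormal θ) (rayNormal θ) = 1 := by
  rw [inner_plane, rayNormal_zero_coord, rayNormal_one_coord]
  linear_combination Real.sin_sq_add_cos_sq θ

theorem inner_polar_rayNormal (ρ θ φ : ℝ) :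
    inner ℝ (polar ρ θ) (rayNormal φ) = ρ * Real.sin (θ - φ) := by
  rw [inner_plane, rayNormal_zero_coord, rayNormal_one_coord, polar_zero_coord, polar_one_coord,
    Real.sin_sub]
  ring

theorem rayNormal_ne_zero (θ : ℝ) : rayNormal θ ≠ 0 := by
  intro h
  have := inner_rayNormal_self θ
  rw [h, inner_zero_left] at this
  exact zero_ne_one this

theorem norm_polar {ρ : ℝ} (hρ : 0 ≤ ρ) (θ : ℝ) : ‖polar ρ θ‖ = ρ := by
  rw [← sq_eq_sq₀ (norm_nonneg _) hρ, ← real_inner_self_eq_norm_sq, inner_plane, polar_zero_coord,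
    polar_one_coord]
  linear_combination ρ ^ 2 * Real.sin_sq_add_cos_sq θ

theorem IsGlobalSolution.isNeumannFlow {θ₁ θ₂ : ℝ} {α₀ : ℝ → Plane} {α : ℝ → ℝ → Plane}
    (h : IsGlobalSolution θ₁ θ₂ α₀ α) : IsNeumannFlow α where
  toIsFlow := h.isFlow
  odd_left n := h.isFlow.curv_odd_eq_zero left_mem_I _ (rayNormal_ne_zero θ₁)
    (fun t ht => (h.boundary t ht).left_flux) (fun t ht => (h.boundary t ht).left_perp) n
  odd_right n := h.isFlow.curv_odd_eq_zero right_mem_I _ (rayNormal_ne_zero θ₂)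
    (fun t ht => (h.boundary t ht).right_flux) (fun t ht => (h.boundary t ht).right_perp) n

namespace IsRegularFamily

variable {α : ℝ → ℝ → Plane} (h : IsRegularFamily α) {p : ℝ × ℝ} {θ t : ℝ}

include h

theorem rayNormal_eq (hp : p ∈ domain) (hn : inner ℝ (nor α p) (rayNormal θ) = 0) :
    rayNormal θ = inner ℝ (rayNormal θ) (tan α p) • tan α p := by
  have := plane_decomposition (h.inner_tan_tan hp) (rayNormal θ)
  rwa [← nor_eq, real_inner_comm (nor α p), hn, zero_smul, add_zero] at this

/-- Perpendicularity makes the tangent parallel to `rayNormal θ`, while the position points along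
the ray. This removes the boundary term in the conservation of area. -/
theorem inner_pos_tan_eq_zero (hp : p ∈ domain) (hn : inner ℝ (nor α p) (rayNormal θ) = 0)
    (hpos : pos α p ∈ ray θ) : inner ℝ (pos α p) (tan α p) = 0 := by
  obtain ⟨ρ, _, hρ⟩ := hpos
  have h1 := inner_polar_rayNormal ρ θ θ
  rw [← hρ, sub_self, Real.sin_zero, mul_zero, h.rayNormal_eq hp hn, inner_smul_right] at h1
  refine (mul_eq_zero.1 h1).resolve_left fun h2 => rayNormal_ne_zero θ ?_
  rw [h.rayNormal_eq hp hn, h2, zero_smul]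

theorem slice_inner_const_hasArcDeriv (w : Plane) (ht : 0 ≤ t) :
    HasArcDeriv (fun u => spd α (u, t)) (fun u => inner ℝ (pos α (u, t)) w)
      (fun u => inner ℝ (tan α (u, t)) w) where
  deriv u hu := by
    have := (h.hasDerivWithinAt_arcD h.smooth (mk_mem_domain hu ht)).inner ℝ
      (hasDerivWithinAt_const u I w)
    refine this.congr_deriv ?_
    rw [inner_zero_right, zero_add, inner_smul_left, ← tan_eq]
    exact mul_comm _ _
  cont := ((h.smooth_tan.inner ℝ contDiffOn_const).continuousOn).comp (by fun_prop)
    fun _ hu => mk_mem_domain hu ht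

theorem norm_tan (hp : p ∈ domain) : ‖tan α p‖ = 1 :=
  norm_eq_one_of_inner_self (h.inner_tan_tan hp)

theorem norm_nor (hp : p ∈ domain) : ‖nor α p‖ = 1 :=
  norm_eq_one_of_inner_self (h.inner_nor_nor hp)

theorem inner_chord_le (w : Plane) (ht : 0 ≤ t) {u : ℝ} (hu : u ∈ I) :
    inner ℝ (pos α (u, t) - pos α (-1, t)) w ≤ ‖w‖ * len α t := by
  have hv := h.slice_spd_continuousOn ht
  have hd := h.slice_inner_const_hasArcDeriv w ht
  have hc := hd.cont
  rw [inner_sub_left, ← integral_of_hasDerivWithinAt hd.deriv (hc.mul hv) left_mem_I hu hu.1, len,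
    ← intervalIntegral.integral_const_mul]
  have hpw : ∀ x ∈ I, inner ℝ (tan α (x, t)) w * spd α (x, t) ≤ ‖w‖ * spd α (x, t) := by
    intro x hx
    apply mul_le_mul_of_nonneg_right _ (h.slice_spd_nonneg ht x hx)
    have := real_inner_le_norm (tan α (x, t)) w
    rwa [h.norm_tan (mk_mem_domain hx ht), one_mul] at this
  have hw : ∀ x ∈ I, 0 ≤ ‖w‖ * spd α (x, t) :=
    fun x hx => mul_nonneg (norm_nonneg _) (h.slice_spd_nonneg ht x hx)
  have hwc : ContinuousOn (fun x => ‖w‖ * spd α (x, t)) I := by fun_prop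
  have hadd := intervalIntegral.integral_add_adjacent_intervals
    (intervalIntegrable_of_continuousOn hwc left_mem_I hu)
    (intervalIntegrable_of_continuousOn hwc hu right_mem_I)
  have h1 := integral_nonneg_I hw hu right_mem_I hu.2
  have h2 : ∫ x in (-1 : ℝ)..u, inner ℝ (tan α (x, t)) w * spd α (x, t) ≤
      ∫ x in (-1 : ℝ)..u, ‖w‖ * spd α (x, t) :=
    intervalIntegral.integral_mono_on hu.1
      (intervalIntegrable_of_continuousOn (hc.mul hv) left_mem_I hu)
      (intervalIntegrable_of_continuousOn hwc left_mem_I hu)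
      fun x hx => hpw x ⟨hx.1, hx.2.trans hu.2⟩
  linarith

theorem norm_chord_le (ht : 0 ≤ t) {u : ℝ} (hu : u ∈ I) :
    ‖pos α (u, t) - pos α (-1, t)‖ ≤ len α t := by
  have h1 := h.inner_chord_le (pos α (u, t) - pos α (-1, t)) ht hu
  rw [real_inner_self_eq_norm_mul_norm] at h1
  rcases (norm_nonneg (pos α (u, t) - pos α (-1, t))).eq_or_lt with h0 | h0
  · rw [← h0]; exact (h.len_pos ht).le
  · exact le_of_mul_le_mul_left h1 h0

/-- The first endpoint, at radius `ρ₁`, lies at distance `ρ₁ sin(θ₁ - θ₂)` from the line of the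
other ray, which the curve reaches; hence `ρ₁ sin(θ₁ - θ₂) ≤ L`. Every other point is within `L` of
that endpoint. -/
theorem norm_pos_le {θ₁ θ₂ : ℝ} (hs : 0 < Real.sin (θ₁ - θ₂)) (ht : 0 ≤ t)
    (hl : pos α (-1, t) ∈ ray θ₁) (hr : pos α (1, t) ∈ ray θ₂) {u : ℝ} (hu : u ∈ I) :
    ‖pos α (u, t)‖ ≤ (1 / Real.sin (θ₁ - θ₂) + 1) * len α t := by
  obtain ⟨ρ₁, h₁, e₁⟩ := hl
  obtain ⟨ρ₂, h₂, e₂⟩ := hr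
  have hn : ‖rayNormal θ₂‖ = 1 := norm_eq_one_of_inner_self (inner_rayNormal_self θ₂)
  have h3 := h.inner_chord_le (-rayNormal θ₂) ht right_mem_I
  rw [inner_neg_right, inner_sub_left, e₁, e₂, inner_polar_rayNormal, inner_polar_rayNormal,
    sub_self, Real.sin_zero, norm_neg, hn] at h3
  have h4 : ρ₁ ≤ 1 / Real.sin (θ₁ - θ₂) * len α t := by
    rw [one_div, inv_mul_eq_div, le_div_iff₀ hs]
    linarith
  have h5 := norm_le_norm_add_norm_sub' (pos α (u, t)) (pos α (-1, t))
  have h6 := h.norm_chord_le ht hu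
  rw [e₁, norm_polar h₁.le] at h5
  rw [e₁] at h6
  linarith

/-- Twice the signed area enclosed by the curve and the cone is controlled by the length. -/
theorem area_le {θ₁ θ₂ : ℝ} (hs : 0 < Real.sin (θ₁ - θ₂)) (ht : 0 ≤ t)
    (hl : pos α (-1, t) ∈ ray θ₁) (hr : pos α (1, t) ∈ ray θ₂) :
    arcInt α (fun p => inner ℝ (pos α p) (nor α p)) t ≤
      (1 / Real.sin (θ₁ - θ₂) + 1) * len α t ^ 2 := by
  have hv := h.slice_spd_continuousOn ht
  have hc : ContinuousOn (fun u => inner ℝ (pos α (u, t)) (nor α (u, t))) I :=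
    ((h.smooth.inner ℝ h.smooth_nor).continuousOn).comp (by fun_prop)
      fun _ hu => mk_mem_domain hu ht
  have : arcInt α (fun p => inner ℝ (pos α p) (nor α p)) t ≤
      ∫ u in (-1 : ℝ)..1, ((1 / Real.sin (θ₁ - θ₂) + 1) * len α t) * spd α (u, t) := by
    refine integral_mono_I (hc.mul hv) (by fun_prop) fun u hu => ?_
    refine mul_le_mul_of_nonneg_right ?_ (h.slice_spd_nonneg ht u hu)
    have h1 := real_inner_le_norm (pos α (u, t)) (nor α (u, t))
    rw [h.norm_nor (mk_mem_domain hu ht), mul_one] at h1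
    exact h1.trans (h.norm_pos_le hs ht hl hr hu)
  rw [intervalIntegral.integral_const_mul, ← len] at this
  linarith

end IsRegularFamily

/-- The signed area enclosed by the curve and the cone is preserved. -/
theorem IsNeumannFlow.area_eq {α : ℝ → ℝ → Plane} (h : IsNeumannFlow α)
    (hb : ∀ t, 0 ≤ t → inner ℝ (pos α (-1, t)) (tan α (-1, t)) = 0 ∧
      inner ℝ (pos α (1, t)) (tan α (1, t)) = 0) {t : ℝ} (ht : 0 ≤ t) :
    arcInt α (fun p => inner ℝ (pos α p) (nor α p)) t =
      arcInt α (fun p => inner ℝ (pos α p) (nor α p)) 0 := by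
  have hr := h.toIsRegularFamily
  have hS := h.smooth.inner ℝ hr.smooth_nor
  have hd : ∀ t, 0 < t → HasDerivAt (arcInt α fun p => inner ℝ (pos α p) (nor α p)) 0 t := by
    intro t ht
    refine (h.toIsFlow.hasDerivAt_arcInt hS ht).congr_deriv ?_
    have hv := hr.slice_spd_continuousOn ht.le
    have e : EqOn (fun p => partialT (fun p => inner ℝ (pos α p) (nor α p)) p +
          curv α 0 p * curv α 2 p * inner ℝ (pos α p) (nor α p))
        (fun p => 1 * (curv α 2 p + curv α 0 p * inner ℝ (pos α p) (nor α p) * curv α 2 p) +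
          (-1) * (inner ℝ (pos α p) (tan α p) * curv α 3 p)) domain := by
      intro p hp
      have := partialT_unique (F := fun p => inner ℝ (pos α p) (nor α p)) hp
        ((hasDerivWithinAt_partialT h.smooth hp).inner ℝ
          (hasDerivWithinAt_partialT hr.smooth_nor hp))
      simp only
      rw [this, Prod.mk.eta, h.flow p hp, h.toIsFlow.partialT_nor hp, inner_neg_right,
        inner_smul_right, inner_smul_left, hr.inner_nor_nor hp, conj_trivial]
      ring
    have hT : HasArcDeriv (fun u => spd α (u, t)) (fun u => inner ℝ (pos α (u, t)) (tan α (u, t)))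
        (fun u => 1 - curv α 0 (u, t) * inner ℝ (pos α (u, t)) (nor α (u, t))) := by
      have h1 := hr.slice_hasArcDeriv (h.smooth.inner ℝ hr.smooth_tan) ht.le
      have h2 : ∀ u ∈ I, arcD α (fun q => inner ℝ (pos α q) (tan α q)) (u, t) =
          1 - curv α 0 (u, t) * inner ℝ (pos α (u, t)) (nor α (u, t)) := by
        intro u hu
        have hp := mk_mem_domain hu ht.le
        rw [hr.arcD_inner h.smooth hr.smooth_tan hp, ← tan_eq, hr.inner_tan_tan hp,
          hr.arcD_tan hp, inner_neg_right, inner_smul_right]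
        ring
      exact ⟨fun u hu => by rw [← h2 u hu]; exact h1.deriv u hu,
        h1.cont.congr fun u hu => (h2 u hu).symm⟩
    have h2 := hT.integral_mul (hr.slice_hasArcDeriv_curv 2 ht.le) hv
    rw [(hb t ht.le).1, (hb t ht.le).2] at h2
    have h3 := h.arcInt_curv_even (n := 0) ht.le
    simp only [mul_zero, zero_add, arcInt] at h3
    have c0 := (hr.slice_hasArcDeriv_curv 0 ht.le).continuousOn
    have c2 := (hr.slice_hasArcDeriv_curv 2 ht.le).continuousOn
    have c3 := (hr.slice_hasArcDeriv_curv 2 ht.le).cont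
    have cT := hT.continuousOn
    have cN : ContinuousOn (fun u => inner ℝ (pos α (u, t)) (nor α (u, t))) I :=
      hS.continuousOn.comp (by fun_prop) fun _ hu => mk_mem_domain hu ht.le
    rw [arcInt_congr α e ht.le, arcInt]
    -- The integrand is `2 k_ss - (⟨γ, τ⟩ k_ss)_s`, because `⟨γ, τ⟩_s = 1 - k ⟨γ, ν⟩`. Both parts
    -- integrate to zero.
    have e4 : ∫ u in (-1 : ℝ)..1, (1 * (curv α 2 (u, t) +
          curv α 0 (u, t) * inner ℝ (pos α (u, t)) (nor α (u, t)) * curv α 2 (u, t)) +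
          (-1) * (inner ℝ (pos α (u, t)) (tan α (u, t)) * curv α 3 (u, t))) * spd α (u, t) =
        ∫ u in (-1 : ℝ)..1, (1 * (2 * (curv α 2 (u, t) * spd α (u, t)) + (-1) *
          ((1 - curv α 0 (u, t) * inner ℝ (pos α (u, t)) (nor α (u, t))) *
            curv α 2 (u, t) * spd α (u, t))) +
          (-1) * (inner ℝ (pos α (u, t)) (tan α (u, t)) * curv α 3 (u, t) * spd α (u, t))) := by
      congr 1; ext u; ring
    rw [e4, integral_lincomb_I (by fun_prop) (by fun_prop) left_mem_I right_mem_I,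
      integral_lincomb_I (by fun_prop) (by fun_prop) left_mem_I right_mem_I, h2, h3]
    ring
  have hc := hr.continuousOn_arcInt hS
  apply le_antisymm
  · exact le_of_deriv_nonpos_above hc hd le_rfl (fun _ _ _ => le_rfl) ht
  · have := le_of_deriv_nonpos_above
      (f := fun s => -arcInt α (fun p => inner ℝ (pos α p) (nor α p)) s) hc.neg
      (fun s hs => (hd s hs).neg) le_rfl (fun _ _ _ => by simp) ht
    simpa using this


/-! ### Positivity of the enclosed area -/

/-- A primitive of `2|x|` that stays differentiable where the curve crosses the bisector; used for
the wedge correction in `area_pos`. -/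
theorem hasDerivAt_mul_abs (x : ℝ) : HasDerivAt (fun y : ℝ => y * |y|) (2 * |x|) x := by
  rcases lt_trichotomy x 0 with hx | rfl | hx
  · have h : HasDerivAt (fun y : ℝ => y * -y) (2 * |x|) x := by
      refine ((hasDerivAt_id x).mul (hasDerivAt_id x).neg).congr_deriv ?_
      rw [abs_of_neg hx]; simp; ring
    refine h.congr_of_eventuallyEq ?_
    filter_upwards [Iio_mem_nhds hx] with y hy
    rw [abs_of_neg hy]
  · rw [hasDerivAt_iff_tendsto_slope]
    have h : Filter.Tendsto (fun y : ℝ => |y|) (nhdsWithin 0 {0}ᶜ) (nhds (2 * |(0 : ℝ)|)) := by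
      have : Filter.Tendsto (fun y : ℝ => |y|) (nhds 0) (nhds |(0 : ℝ)|) := continuous_abs.tendsto 0
      simpa using this.mono_left nhdsWithin_le_nhds
    refine h.congr' ?_
    filter_upwards [self_mem_nhdsWithin] with y hy
    have hy : y ≠ 0 := hy
    simp [slope, hy]
  · have h : HasDerivAt (fun y : ℝ => y * y) (2 * |x|) x := by
      refine ((hasDerivAt_id x).mul (hasDerivAt_id x)).congr_deriv ?_
      rw [abs_of_pos hx]; simp; ring
    refine h.congr_of_eventuallyEq ?_
    filter_upwards [Ioi_mem_nhds hx] with y hy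
    rw [abs_of_pos hy]

theorem rotate_coords {x y : Plane} (h : y = rotate x) : x 0 = y 1 ∧ x 1 = -y 0 := by
  rw [h, rotate_zero_coord, rotate_one_coord]
  simp

/-- In coordinates adapted to the bisector of the cone, the height of a point over the cone. -/
theorem sector_height {ρ θ m β : ℝ} (hβ : β ≤ Real.pi / 2) (h : |θ - m| ≤ β) :
    (ρ * Real.cos (θ - m)) * Real.sin β - |(-(ρ * Real.sin (θ - m)))| * Real.cos β =
      (ρ - |ρ|) * Real.cos (θ - m) * Real.sin β + |ρ| * Real.sin (β - |θ - m|) := by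
  have h1 : |Real.sin (θ - m)| = Real.sin |θ - m| := by
    have hpi := Real.pi_pos
    rcases le_total 0 (θ - m) with h0 | h0
    · rw [abs_of_nonneg h0] at h ⊢
      exact abs_of_nonneg (Real.sin_nonneg_of_nonneg_of_le_pi h0 (by linarith))
    · rw [abs_of_nonpos h0] at h ⊢
      rw [Real.sin_neg]
      exact abs_of_nonpos (Real.sin_nonpos_of_nonpos_of_neg_pi_le h0 (by linarith))
  rw [abs_neg, abs_mul, h1, Real.sin_sub, Real.cos_abs]
  ring

namespace IsRegularFamily

variable {α : ℝ → ℝ → Plane} (h : IsRegularFamily α) {θ₁ θ₂ t : ℝ}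

include h

/-- A curve that stays inside the cone starts with the outer normal. -/
theorem nor_left (hθ₂ : 0 ≤ θ₂) (hθ₁ : θ₁ < Real.pi) (ht : 0 ≤ t)
    (hin : ∀ u ∈ Ioo (-1 : ℝ) 1, pos α (u, t) ∈ sector θ₁ θ₂) (hl : pos α (-1, t) ∈ ray θ₁)
    (hn : inner ℝ (nor α (-1, t)) (rayNormal θ₁) = 0) : nor α (-1, t) = polar 1 θ₁ := by
  have hp := mk_mem_domain left_mem_I ht
  have hd : HasDerivWithinAt (fun u => inner ℝ (pos α (u, t)) (rayNormal θ₁))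
      (inner ℝ (tan α (-1, t)) (rayNormal θ₁) * spd α (-1, t)) (Ioo (-1) 1) (-1) :=
    ((h.slice_inner_const_hasArcDeriv (rayNormal θ₁) ht).deriv (-1) left_mem_I).mono
      Ioo_subset_Icc_self
  have h0 : inner ℝ (pos α (-1, t)) (rayNormal θ₁) = 0 := by
    obtain ⟨ρ, _, e⟩ := hl
    rw [e, inner_polar_rayNormal, sub_self, Real.sin_zero, mul_zero]
  -- Interior points have angle below `θ₁`, so the difference quotients of the `rayNormal θ₁`
  -- component are nonpositive. This fixes the sign that perpendicularity leaves open.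
  have h1 : inner ℝ (tan α (-1, t)) (rayNormal θ₁) * spd α (-1, t) ≤ 0 := by
    rw [hasDerivWithinAt_iff_tendsto_slope' (by simp)] at hd
    have : (nhdsWithin (-1 : ℝ) (Ioo (-1) 1)).NeBot := left_nhdsWithin_Ioo_neBot (by norm_num)
    refine le_of_tendsto hd ?_
    filter_upwards [self_mem_nhdsWithin] with u hu
    obtain ⟨ρ, θ, hρ, h2, h3, e⟩ := hin u hu
    rw [slope_def_field, h0, sub_zero, e, inner_polar_rayNormal]
    refine div_nonpos_of_nonpos_of_nonneg ?_ (by linarith [hu.1])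
    exact mul_nonpos_of_nonneg_of_nonpos hρ.le
      (Real.sin_nonpos_of_nonpos_of_neg_pi_le (by linarith) (by linarith))
  have h2 : inner ℝ (tan α (-1, t)) (rayNormal θ₁) ≤ 0 :=
    nonpos_of_mul_nonpos_left h1 (h.spd_pos hp)
  have h3 := h.rayNormal_eq hp hn
  have h4 := inner_rayNormal_self θ₁
  obtain ⟨a, ha⟩ : ∃ a, a = inner ℝ (rayNormal θ₁) (tan α (-1, t)) := ⟨_, rfl⟩
  rw [real_inner_comm, ← ha] at h2
  rw [← ha] at h3
  have h5 : a = -1 := by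
    rw [h3, inner_smul_left, inner_smul_right, h.inner_tan_tan hp, conj_trivial, mul_one] at h4
    nlinarith
  rw [h5, neg_one_smul] at h3
  have h6 : tan α (-1, t) = -rayNormal θ₁ := by rw [h3, neg_neg]
  rw [nor_eq, h6]
  apply plane_ext
  · rw [rotate_zero_coord, polar_zero_coord, PiLp.neg_apply, rayNormal_one_coord]; ring
  · rw [rotate_one_coord, polar_one_coord, PiLp.neg_apply, rayNormal_zero_coord]; ring

theorem slice_coord_hasArcDeriv (i : Fin 2) {X : ℝ × ℝ → Plane} (hX : ContDiffOn ℝ ∞ X domain)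
    (ht : 0 ≤ t) :
    HasArcDeriv (fun u => spd α (u, t)) (fun u => X (u, t) i) (fun u => arcD α X (u, t) i) where
  deriv u hu := by
    have := (EuclideanSpace.proj (𝕜 := ℝ) i : Plane →L[ℝ] ℝ).hasFDerivAt.comp_hasDerivWithinAt u
      (h.hasDerivWithinAt_arcD hX (mk_mem_domain hu ht))
    refine this.congr_deriv ?_
    simp [mul_comm]
  cont := by
    have := (EuclideanSpace.proj (𝕜 := ℝ) i : Plane →L[ℝ] ℝ).continuous.comp_continuousOn
      (h.smooth_arcD hX).continuousOn
    exact this.comp (f := fun u => (u, t)) (by fun_prop) fun _ hu => mk_mem_domain hu ht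

/-- The normal angle of a curve. -/
theorem exists_normal_angle (ht : 0 ≤ t) (hn : nor α (-1, t) = polar 1 θ₁) :
    ∃ ψ : ℝ → ℝ, ψ (-1) = θ₁ ∧
      HasArcDeriv (fun u => spd α (u, t)) ψ (fun u => -curv α 0 (u, t)) ∧
      ∀ u ∈ I, nor α (u, t) = polar 1 (ψ u) := by
  have hv := h.slice_spd_continuousOn ht
  have hk := (h.slice_hasArcDeriv_curv 0 ht).continuousOn
  obtain ⟨G, hG0, hG⟩ := exists_primitive (hk.neg.mul hv)
  have hψ : HasArcDeriv (fun u => spd α (u, t)) (fun u => θ₁ + G u) (fun u => -curv α 0 (u, t)) :=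
    ⟨fun u hu => (hG u hu).const_add θ₁, hk.neg⟩
  refine ⟨fun u => θ₁ + G u, by simp [hG0], hψ, fun u hu => ?_⟩
  have h0 := h.slice_coord_hasArcDeriv 0 h.smooth_nor ht
  have h1 := h.slice_coord_hasArcDeriv 1 h.smooth_nor ht
  -- The inner product of `ν` with the unit vector at the candidate angle is constant and starts at
  -- `1`; unit vectors with inner product `1` coincide.
  have hd : ∀ x ∈ I, HasDerivWithinAt (fun x => nor α (x, t) 0 * Real.cos (θ₁ + G x) +
      nor α (x, t) 1 * Real.sin (θ₁ + G x)) 0 I x := by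
    intro x hx
    have hp := mk_mem_domain hx ht
    have hc := (hψ.deriv x hx).cos
    have hs := (hψ.deriv x hx).sin
    refine (((h0.deriv x hx).mul hc).add ((h1.deriv x hx).mul hs)).congr_deriv ?_
    obtain ⟨e0, e1⟩ := rotate_coords (nor_eq α (x, t))
    simp only [h.arcD_nor hp, PiLp.smul_apply, smul_eq_mul, e0, e1]
    ring
  have hI := integral_of_hasDerivWithinAt hd continuousOn_const left_mem_I hu hu.1
  rw [intervalIntegral.integral_zero, hn, hG0, polar_zero_coord, polar_one_coord] at hI
  have e2 := Real.sin_sq_add_cos_sq (θ₁ + 0)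
  rw [add_zero] at e2 hI
  have e3 : nor α (u, t) 0 * Real.cos (θ₁ + G u) + nor α (u, t) 1 * Real.sin (θ₁ + G u) = 1 := by
    linarith
  have e4 := h.inner_nor_nor (mk_mem_domain hu ht)
  rw [inner_plane] at e4
  have e5 := Real.sin_sq_add_cos_sq (θ₁ + G u)
  have e6 : (nor α (u, t) 0 - Real.cos (θ₁ + G u)) ^ 2 +
      (nor α (u, t) 1 - Real.sin (θ₁ + G u)) ^ 2 = 0 := by
    linear_combination e4 + e5 - 2 * e3
  apply plane_ext
  · rw [polar_zero_coord]
    nlinarith [sq_nonneg (nor α (u, t) 0 - Real.cos (θ₁ + G u)),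
      sq_nonneg (nor α (u, t) 1 - Real.sin (θ₁ + G u))]
  · rw [polar_one_coord]
    nlinarith [sq_nonneg (nor α (u, t) 0 - Real.cos (θ₁ + G u)),
      sq_nonneg (nor α (u, t) 1 - Real.sin (θ₁ + G u))]

/-- The total curvature of a curve whose rotation number is below one half is the angle of the
cone. -/
theorem total_curvature_eq_angle {ψ : ℝ → ℝ} (hθ₂ : 0 ≤ θ₂) (hθ : θ₂ < θ₁) (hθ₁ : θ₁ < Real.pi)
    (ht : 0 ≤ t) (hψ0 : ψ (-1) = θ₁)
    (hψ : HasArcDeriv (fun u => spd α (u, t)) ψ (fun u => -curv α 0 (u, t)))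
    (hnψ : ∀ u ∈ I, nor α (u, t) = polar 1 (ψ u))
    (hn : inner ℝ (nor α (1, t)) (rayNormal θ₂) = 0)
    (hW0 : 0 < arcInt α (curv α 0) t) (hW : arcInt α (curv α 0) t < Real.pi) :
    arcInt α (curv α 0) t = θ₁ - θ₂ := by
  have h1 := hψ.integral (h.slice_spd_continuousOn ht)
  simp only [neg_mul] at h1
  rw [intervalIntegral.integral_neg, ← arcInt, hψ0] at h1
  rw [hnψ 1 right_mem_I, inner_polar_rayNormal, one_mul] at hn
  -- Perpendicularity fixes the final angle modulo `π`. Both the total curvature and `θ₁ - θ₂` lie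
  -- in `(0, π)`, so they differ by less than `π` and must agree.
  have h2 := (Real.sin_eq_zero_iff_of_lt_of_lt (by linarith) (by linarith)).1 hn
  linarith

/-- If the oscillation of curvature is small, the curve is a graph over a line orthogonal to
the bisector of the cone. -/
theorem abs_angle_sub_lt {ψ : ℝ → ℝ} (ht : 0 ≤ t) (hψ0 : ψ (-1) = θ₁)
    (hψ : HasArcDeriv (fun u => spd α (u, t)) ψ (fun u => -curv α 0 (u, t)))
    (hW : arcInt α (curv α 0) t = θ₁ - θ₂) (hθ : θ₂ < θ₁) (hlt : θ₁ - θ₂ < Real.pi)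
    (hosc : len α t * arcInt α (fun p => curv α 0 p ^ 2) t - (θ₁ - θ₂) ^ 2 <
      (Real.pi - (θ₁ - θ₂)) ^ 2) {u : ℝ} (hu : u ∈ I) :
    |ψ u - (θ₁ + θ₂) / 2| < Real.pi / 2 := by
  have hv := h.slice_spd_continuousOn ht
  have hv0 := h.slice_spd_nonneg ht
  have hL := h.len_pos ht
  have hk := (h.slice_hasArcDeriv_curv 0 ht).continuousOn
  obtain ⟨s, hs0, hs⟩ := exists_primitive hv
  have hs1 := integral_of_hasDerivWithinAt hs hv left_mem_I right_mem_I (by norm_num)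
  have hsu := integral_of_hasDerivWithinAt hs hv left_mem_I hu hu.1
  have hsu' := integral_of_hasDerivWithinAt hs hv hu right_mem_I hu.2
  have n1 := integral_nonneg_I hv0 left_mem_I hu hu.1
  have n2 := integral_nonneg_I hv0 hu right_mem_I hu.2
  rw [← len, hs0, sub_zero] at hs1
  set L := len α t with hLdef
  set W := θ₁ - θ₂ with hWdef
  set c := W / L with hc
  have hcL : c * L = W := div_mul_cancel₀ _ hL.ne'
  -- The deviation of the normal angle from linear interpolation in arclength vanishes at both ends
  -- and has derivative `k` minus its mean. Its square is thus at most `K/4 < ((π - W)/2)²`, while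
  -- the linear part stays within `W/2` of the bisector.
  have hg : HasArcDeriv (fun u => spd α (u, t)) (fun u => θ₁ - ψ u - c * s u)
      (fun u => curv α 0 (u, t) - c) :=
    ⟨fun x hx => (((hψ.deriv x hx).const_sub θ₁).sub ((hs x hx).const_mul c)).congr_deriv
      (by ring), by fun_prop⟩
  have hψ1 := hψ.integral hv
  simp only [neg_mul] at hψ1
  rw [intervalIntegral.integral_neg, ← arcInt, hψ0, hW] at hψ1
  have hd := sq_le_of_dirichlet hg hv hv0 (by simp [hψ0, hs0]) (by rw [← hs1, hcL]; linarith) hu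
  rw [osc_eq hv hk c, ← len, ← hLdef] at hd
  have hP : ∫ u in (-1 : ℝ)..1, curv α 0 (u, t) ^ 2 * spd α (u, t) =
    arcInt α (fun p => curv α 0 p ^ 2) t := rfl
  have hW' : ∫ u in (-1 : ℝ)..1, curv α 0 (u, t) * spd α (u, t) = W := hW
  rw [hP, hW'] at hd
  set P := arcInt α (fun p => curv α 0 p ^ 2) t
  have hd2 : (θ₁ - ψ u - c * s u) ^ 2 < ((Real.pi - W) / 2) ^ 2 := by
    have : L / 4 * (P - 2 * c * W + c ^ 2 * L) = (L * P - W ^ 2) / 4 := by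
      linear_combination (c * L - 2 * W + W) / 4 * hcL
    rw [this] at hd
    nlinarith
  have hd3 := abs_lt_of_sq_lt_sq hd2 (by linarith)
  rw [abs_lt] at hd3
  have hsu0 : 0 ≤ s u := by linarith
  have hsuL : s u ≤ L := by linarith
  have hc0 : 0 ≤ c := div_nonneg (by linarith) hL.le
  have hcs : c * s u ≤ W := by rw [← hcL]; gcongr
  have hcs0 : 0 ≤ c * s u := by positivity
  rw [abs_lt]
  constructor <;> linarith [hd3.1, hd3.2]

/-- The curve is a graph over the `x` axis, lying above the wedge `y sin β = |x| cos β` formed by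
the two rays. The area is an integral of the positive height above the wedge, up to an exact
derivative. -/
theorem area_pos {ψ : ℝ → ℝ} (ht : 0 ≤ t) (hθ : θ₂ < θ₁) (hlt : θ₁ - θ₂ < Real.pi)
    (hnψ : ∀ u ∈ I, nor α (u, t) = polar 1 (ψ u))
    (hψ : ∀ u ∈ I, |ψ u - (θ₁ + θ₂) / 2| < Real.pi / 2)
    (hin : ∀ u ∈ Ioo (-1 : ℝ) 1, pos α (u, t) ∈ sector θ₁ θ₂)
    (hl : pos α (-1, t) ∈ ray θ₁) (hr : pos α (1, t) ∈ ray θ₂) :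
    0 < arcInt α (fun p => inner ℝ (pos α p) (nor α p)) t := by
  have hv := h.slice_spd_continuousOn ht
  set m := (θ₁ + θ₂) / 2 with hm
  set β := (θ₁ - θ₂) / 2 with hβ
  have hβ0 : 0 < β := by linarith
  have hβ1 : β < Real.pi / 2 := by linarith
  have hsβ : 0 < Real.sin β := Real.sin_pos_of_pos_of_lt_pi hβ0 (by linarith)
  set a := Real.cos m
  set b := Real.sin m
  have hab : b ^ 2 + a ^ 2 = 1 := Real.sin_sq_add_cos_sq m
  have c0 := h.slice_coord_hasArcDeriv 0 h.smooth ht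
  have c1 := h.slice_coord_hasArcDeriv 1 h.smooth ht
  have cc0 := c0.continuousOn
  have cc1 := c1.continuousOn
  have cd0 := c0.cont
  have cd1 := c1.cont
  -- The `y` axis is the bisector and `x` increases from the ray at `θ₁` to the ray at `θ₂`, so that
  -- `x_s = cos(ψ - m)`.
  set x : ℝ → ℝ := fun u => pos α (u, t) 0 * b - pos α (u, t) 1 * a with hx
  set y : ℝ → ℝ := fun u => pos α (u, t) 0 * a + pos α (u, t) 1 * b with hy
  set x' : ℝ → ℝ := fun u => arcD α (pos α) (u, t) 0 * b - arcD α (pos α) (u, t) 1 * a with hx'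
  set y' : ℝ → ℝ := fun u => arcD α (pos α) (u, t) 0 * a + arcD α (pos α) (u, t) 1 * b with hy'
  have dx : HasArcDeriv (fun u => spd α (u, t)) x x' :=
    ⟨fun u hu => (((c0.deriv u hu).mul_const b).sub ((c1.deriv u hu).mul_const a)).congr_deriv
      (by simp only [hx']; ring), by fun_prop⟩
  have dy : HasArcDeriv (fun u => spd α (u, t)) y y' :=
    ⟨fun u hu => (((c0.deriv u hu).mul_const a).add ((c1.deriv u hu).mul_const b)).congr_deriv
      (by simp only [hy']; ring), by fun_prop⟩
  have hxc := dx.continuousOn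
  have hyc := dy.continuousOn
  have hxc' := dx.cont
  have hyc' := dy.cont
  -- The correction `x (|x| cos β - y sin β)` vanishes on both rays, so its derivative integrates to
  -- zero.
  have dS : HasArcDeriv (fun u => spd α (u, t))
      (fun u => x u * |x u| * Real.cos β - x u * y u * Real.sin β)
      (fun u => 2 * |x u| * x' u * Real.cos β - (x' u * y u + x u * y' u) * Real.sin β) := by
    refine ⟨fun u hu => ?_, by fun_prop⟩
    have e1 := ((hasDerivAt_mul_abs (x u)).comp_hasDerivWithinAt u (dx.deriv u hu)).mul_const
      (Real.cos β)
    have e2 := ((dx.mul dy).deriv u hu).mul_const (Real.sin β)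
    exact (e1.sub e2).congr_deriv (by ring)
  have hpolar : ∀ u ρ θ, pos α (u, t) = polar ρ θ →
      x u = -(ρ * Real.sin (θ - m)) ∧ y u = ρ * Real.cos (θ - m) := by
    intro u ρ θ e
    simp only [hx, hy]
    rw [e, polar_zero_coord, polar_one_coord, Real.sin_sub, Real.cos_sub]
    constructor <;> ring
  have hend : ∀ u ρ θ, 0 < ρ → |θ - m| = β → pos α (u, t) = polar ρ θ →
      x u * |x u| * Real.cos β - x u * y u * Real.sin β = 0 := by
    intro u ρ θ hρ hθβ e
    obtain ⟨ex, ey⟩ := hpolar u ρ θ e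
    have := sector_height (ρ := ρ) hβ1.le hθβ.le
    rw [← ex, ← ey, abs_of_pos hρ, hθβ, sub_self, sub_self, Real.sin_zero] at this
    linear_combination (-x u) * this
  have hS1 : x (-1) * |x (-1)| * Real.cos β - x (-1) * y (-1) * Real.sin β = 0 := by
    obtain ⟨ρ, hρ, e⟩ := hl
    refine hend _ ρ θ₁ hρ ?_ e
    rw [abs_of_pos] <;> linarith
  have hS2 : x 1 * |x 1| * Real.cos β - x 1 * y 1 * Real.sin β = 0 := by
    obtain ⟨ρ, hρ, e⟩ := hr
    refine hend _ ρ θ₂ hρ ?_ e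
    rw [abs_of_neg] <;> linarith
  have hSint := dS.integral hv
  rw [hS1, hS2, sub_zero] at hSint
  set H : ℝ → ℝ := fun u => (y u * Real.sin β - |x u| * Real.cos β) * x' u with hH
  have hHc : ContinuousOn H I := by fun_prop
  have hHpos : 0 < ∫ u in (-1 : ℝ)..1, H u * spd α (u, t) := by
    apply intervalIntegral.intervalIntegral_pos_of_pos_on
      (intervalIntegrable_of_continuousOn (hHc.mul hv) left_mem_I right_mem_I) _ (by norm_num)
    intro u hu
    have huI : u ∈ I := Ioo_subset_Icc_self hu
    refine mul_pos (mul_pos ?_ ?_) (h.slice_spd_pos ht u huI)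
    · obtain ⟨ρ, θ, hρ, h2, h3, e⟩ := hin u hu
      obtain ⟨ex, ey⟩ := hpolar u ρ θ e
      have hlt : |θ - m| < β := by rw [abs_lt]; constructor <;> linarith
      have := sector_height (ρ := ρ) hβ1.le hlt.le
      rw [← ex, ← ey, abs_of_pos hρ, sub_self] at this
      rw [this]
      have : 0 < Real.sin (β - |θ - m|) :=
        Real.sin_pos_of_pos_of_lt_pi (by linarith) (by linarith [abs_nonneg (θ - m), Real.pi_pos])
      nlinarith [mul_pos hρ this]
    · obtain ⟨e0, e1⟩ := rotate_coords (nor_eq α (u, t))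
      simp only [hx']
      rw [← tan_eq, e0, e1, hnψ u huI, polar_zero_coord, polar_one_coord]
      have := Real.cos_pos_of_mem_Ioo (abs_lt.1 (hψ u huI))
      rw [Real.cos_sub] at this
      linarith
  have key : Real.sin β * arcInt α (fun p => inner ℝ (pos α p) (nor α p)) t =
      2 * ∫ u in (-1 : ℝ)..1, H u * spd α (u, t) := by
    have hSc := dS.cont
    rw [arcInt, ← intervalIntegral.integral_const_mul]
    have : ∫ u in (-1 : ℝ)..1,
          Real.sin β * (inner ℝ (pos α (u, t)) (nor α (u, t)) * spd α (u, t)) =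
        ∫ u in (-1 : ℝ)..1, (2 * (H u * spd α (u, t)) + 1 * ((2 * |x u| * x' u * Real.cos β -
          (x' u * y u + x u * y' u) * Real.sin β) * spd α (u, t))) := by
      congr 1
      ext u
      obtain ⟨e0, e1⟩ := rotate_coords (nor_eq α (u, t))
      have e2 : inner ℝ (pos α (u, t)) (nor α (u, t)) = y u * x' u - x u * y' u := by
        simp only [hx, hy, hx', hy', inner_plane]
        rw [← tan_eq, e0, e1]
        linear_combination (-(pos α (u, t) 0 * nor α (u, t) 0) -
          pos α (u, t) 1 * nor α (u, t) 1) * hab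
      rw [e2]
      simp only [hH]
      ring
    have hHv : ContinuousOn (fun u => H u * spd α (u, t)) I := hHc.mul hv
    have hSv := hSc.mul hv
    rw [this]
    exact (integral_lincomb_I hHv hSv left_mem_I right_mem_I 2 1).trans (by
      simp only [Pi.mul_apply]
      rw [hSint]
      ring)
  have : 0 < Real.sin β * arcInt α (fun p => inner ℝ (pos α p) (nor α p)) t := by
    rw [key]; linarith
  exact pos_of_mul_pos_right this hsβ.le

end IsRegularFamily


/-! ### Interpolation -/

/-- A discrete maximum principle. At the first index where a maximum above `1` is attained, the left
neighbour is strictly smaller, contradicting log-convexity. -/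
theorem le_one_of_sq_le_mul {r : ℕ → ℝ} {n : ℕ} (h0 : r 0 ≤ 1) (hn : r n ≤ 1)
    (hr : ∀ i, 0 ≤ r i) (h : ∀ i, i + 2 ≤ n → r (i + 1) ^ 2 ≤ r i * r (i + 2)) {i : ℕ}
    (hi : i ≤ n) : r i ≤ 1 := by
  obtain ⟨j, hj, hmax⟩ := Finset.exists_max_image (Finset.range (n + 1)) r ⟨0, by simp⟩
  rw [Finset.mem_range] at hj
  have hmax' : ∀ k, k ≤ n → r k ≤ r j := fun k hk => hmax k (Finset.mem_range.2 (by omega))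
  refine (hmax' i hi).trans ?_
  by_contra! hlt
  classical
  have hex : ∃ k, k ≤ n ∧ r k = r j := ⟨j, by omega, rfl⟩
  obtain ⟨hk, hkr⟩ := Nat.find_spec hex
  have hmin := fun l (hl : l < Nat.find hex) => Nat.find_min hex hl
  generalize Nat.find hex = k at hk hkr hmin
  match k with
  | 0 => linarith
  | k + 1 =>
    have hkn : k + 1 ≠ n := by
      rintro rfl
      linarith
    have h1 : r k < r j :=
      lt_of_le_of_ne (hmax' k (by omega)) fun e => hmin k (by omega) ⟨by omega, e⟩
    have h2 := hmax' (k + 2) (by omega)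
    have h3 := h k (by omega)
    rw [hkr] at h3
    nlinarith [hr k, hr (k + 2)]

/-- Interpolation between the first and the last term of a log-convex sequence. -/
theorem le_mul_pow_of_sq_le_mul {N : ℕ → ℝ} {n : ℕ} {C q : ℝ} (hC : 1 ≤ C) (hq : 1 ≤ q)
    (h0 : N 0 ≤ C) (hn : N n ≤ q ^ n) (hN : ∀ i, 0 ≤ N i)
    (h : ∀ i, i + 2 ≤ n → N (i + 1) ^ 2 ≤ N i * N (i + 2)) {i : ℕ} (hi : i ≤ n) :
    N i ≤ C * q ^ i := by
  have hC0 : 0 < C := by linarith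
  have hq0 : 0 < q := by linarith
  have hpos : ∀ i, 0 < C * q ^ i := fun i => by positivity
  -- For the geometric sequence `C q^i` log-convexity is an equality, so the quotient is again
  -- log-convex.
  have key := le_one_of_sq_le_mul (r := fun i => N i / (C * q ^ i)) (n := n)
    ((div_le_one (hpos 0)).2 (by simpa using h0))
    ((div_le_one (hpos n)).2 (hn.trans (le_mul_of_one_le_left (by positivity) hC)))
    (fun i => div_nonneg (hN i) (hpos i).le) (fun i hi => ?_) hi
  · exact (div_le_one (hpos i)).1 key
  · rw [div_pow, div_mul_div_comm]
    rw [show (C * q ^ (i + 1)) ^ 2 = C * q ^ i * (C * q ^ (i + 2)) by ring]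
    exact div_le_div_of_nonneg_right (h i hi) (by positivity)

/-- The `L²` norm of the `i`-th derivative of the curvature. -/
def nrm (α : ℝ → ℝ → Plane) (i : ℕ) (t : ℝ) : ℝ := √(arcInt α (fun p => curv α i p ^ 2) t)

namespace IsRegularFamily

variable {α : ℝ → ℝ → Plane} (h : IsRegularFamily α) {t : ℝ}

include h

theorem sq_nrm (i : ℕ) (ht : 0 ≤ t) : nrm α i t ^ 2 = arcInt α (fun p => curv α i p ^ 2) t :=
  Real.sq_sqrt (integral_nonneg_I (fun u hu => mul_nonneg (sq_nonneg _)
    (h.slice_spd_nonneg ht u hu)) left_mem_I right_mem_I (by norm_num))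

omit h in
theorem slice_continuousOn {f : ℝ × ℝ → ℝ} (hf : ContDiffOn ℝ ∞ f domain) (ht : 0 ≤ t) :
    ContinuousOn (fun u => f (u, t)) I :=
  hf.continuousOn.comp (by fun_prop) fun _ hu => mk_mem_domain hu ht

theorem arcInt_lincomb {f g : ℝ × ℝ → ℝ} (hf : ContDiffOn ℝ ∞ f domain)
    (hg : ContDiffOn ℝ ∞ g domain) (x y : ℝ) (ht : 0 ≤ t) :
    arcInt α (fun p => x * f p + y * g p) t = x * arcInt α f t + y * arcInt α g t := by
  have hv := h.slice_spd_continuousOn ht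
  have cf : ContinuousOn (fun u => f (u, t) * spd α (u, t)) I := (slice_continuousOn hf ht).mul hv
  have cg : ContinuousOn (fun u => g (u, t) * spd α (u, t)) I := (slice_continuousOn hg ht).mul hv
  unfold arcInt
  rw [← integral_lincomb_I cf cg left_mem_I right_mem_I]
  congr 1; ext u; ring

/-- In powers of `q`, the sup norm of `k_i` costs half an order more than its `L²` norm; the term
with `1/l` has lower order and is absorbed by `q ≥ 1`. -/
theorem curv_sq_le {l C q : ℝ} {i : ℕ} (ht : 0 ≤ t) (hl : 0 < l) (hlen : l ≤ len α t) (hC : 0 ≤ C)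
    (hq : 1 ≤ q) (hi : nrm α i t ≤ C * q ^ i) (hi' : nrm α (i + 1) t ≤ C * q ^ (i + 1)) :
    ∀ u ∈ I, curv α i (u, t) ^ 2 ≤ C ^ 2 * (1 / l + 2) * q ^ (2 * i + 1) := by
  intro u hu
  have h1 := sq_le_of_norms (h.slice_hasArcDeriv_curv i ht) (h.slice_spd_continuousOn ht)
    (h.slice_spd_nonneg ht) (h.len_pos ht) hu
  change _ ≤ arcInt α (fun p => curv α i p ^ 2) t / len α t + 2 * (nrm α i t * nrm α (i + 1) t)
    at h1
  rw [← h.sq_nrm i ht] at h1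
  have n0 : 0 ≤ nrm α i t := Real.sqrt_nonneg _
  have n1 : 0 ≤ nrm α (i + 1) t := Real.sqrt_nonneg _
  have hq0 : 0 < q := by linarith
  have h2 : nrm α i t ^ 2 / len α t ≤ (C * q ^ i) ^ 2 / l := by gcongr
  have h3 : nrm α i t * nrm α (i + 1) t ≤ (C * q ^ i) * (C * q ^ (i + 1)) := by gcongr
  have h4 : q ^ (2 * i) ≤ q ^ (2 * i + 1) := pow_le_pow_right₀ hq (by omega)
  have h5 : (C * q ^ i) ^ 2 / l ≤ C ^ 2 * (1 / l) * q ^ (2 * i + 1) := by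
    calc (C * q ^ i) ^ 2 / l = C ^ 2 * (1 / l) * q ^ (2 * i) := by ring
      _ ≤ _ := by gcongr
  calc _ ≤ _ := h1
    _ ≤ C ^ 2 * (1 / l) * q ^ (2 * i + 1) + 2 * ((C * q ^ i) * (C * q ^ (i + 1))) := by linarith
    _ = _ := by ring

/-- Put `k_c` and `k_m` in the sup norm and `k_a`, `k_b` in `L²`. The exponents add to `(c + 1/2) +
(m + 1/2) + a + b = 2m + 3`, one below the dissipation. -/
theorem abs_arcInt_quartic_le {S C q : ℝ} {m a b c : ℕ} (ht : 0 ≤ t) (hC : 0 ≤ C) (hS : 0 ≤ S)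
    (hq : 1 ≤ q) (hN : ∀ i, i ≤ m + 2 → nrm α i t ≤ C * q ^ i)
    (hsup : ∀ i, i ≤ m + 1 → ∀ u ∈ I, curv α i (u, t) ^ 2 ≤ S * q ^ (2 * i + 1))
    (habc : a + b + c = m + 2) (hc : c ≤ m + 1) :
    |arcInt α (fun p => curv α a p * curv α b p * curv α c p * curv α m p) t| ≤
      S * C ^ 2 * q ^ (2 * m + 3) := by
  have hv := h.slice_spd_continuousOn ht
  have hv0 := h.slice_spd_nonneg ht
  have ca := slice_continuousOn (h.smooth_curv a) ht
  have cb := slice_continuousOn (h.smooth_curv b) ht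
  have cc := slice_continuousOn (h.smooth_curv c) ht
  have cm := slice_continuousOn (h.smooth_curv m) ht
  have hq0 : 0 < q := by linarith
  have hpt : ∀ u ∈ I, |curv α c (u, t) * curv α m (u, t)| ≤ S * q ^ (c + m + 1) := by
    intro u hu
    apply abs_le_of_sq_le_sq _ (by positivity)
    rw [mul_pow]
    calc _ ≤ (S * q ^ (2 * c + 1)) * (S * q ^ (2 * m + 1)) :=
          mul_le_mul (hsup c hc u hu) (hsup m (by omega) u hu) (sq_nonneg _) (by positivity)
      _ = _ := by ring
  have h1 : |arcInt α (fun p => curv α a p * curv α b p * curv α c p * curv α m p) t| ≤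
      ∫ u in (-1 : ℝ)..1, (S * q ^ (c + m + 1)) *
        (|curv α a (u, t)| * |curv α b (u, t)| * spd α (u, t)) := by
    refine (intervalIntegral.abs_integral_le_integral_abs (by norm_num)).trans ?_
    refine integral_mono_I (by fun_prop) (by fun_prop) fun u hu => ?_
    have h2 := hpt u hu
    have h3 : 0 ≤ |curv α a (u, t)| * |curv α b (u, t)| * spd α (u, t) :=
      mul_nonneg (by positivity) (hv0 u hu)
    calc |curv α a (u, t) * curv α b (u, t) * curv α c (u, t) * curv α m (u, t) * spd α (u, t)| =
          |curv α c (u, t) * curv α m (u, t)| *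
            (|curv α a (u, t)| * |curv α b (u, t)| * spd α (u, t)) := by
          simp only [abs_mul, abs_of_nonneg (hv0 u hu)]
          ring
      _ ≤ _ := mul_le_mul_of_nonneg_right h2 h3
  rw [intervalIntegral.integral_const_mul] at h1
  have h2 : ∫ u in (-1 : ℝ)..1, |curv α a (u, t)| * |curv α b (u, t)| * spd α (u, t) ≤
      nrm α a t * nrm α b t := by
    have cs := cauchy_schwarz hv hv0 ca.abs cb.abs left_mem_I right_mem_I (by norm_num)
    simp only [sq_abs] at cs
    have hn : 0 ≤ nrm α a t * nrm α b t := mul_nonneg (Real.sqrt_nonneg _) (Real.sqrt_nonneg _)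
    refine le_of_sq_le_sq ?_ hn
    rw [mul_pow, h.sq_nrm a ht, h.sq_nrm b ht]
    exact cs
  have h3 : nrm α a t * nrm α b t ≤ (C * q ^ a) * (C * q ^ b) :=
    mul_le_mul (hN a (by omega)) (hN b (by omega)) (Real.sqrt_nonneg _) (by positivity)
  calc _ ≤ _ := h1
    _ ≤ (S * q ^ (c + m + 1)) * ((C * q ^ a) * (C * q ^ b)) := by
      gcongr
      exact h2.trans h3
    _ = S * C ^ 2 * q ^ ((a + b + c) + m + 1) := by ring
    _ = _ := by rw [habc]; congr 2; ring

/-- Cubic expressions of order `m + 2`, tested against the `m`-th derivative of the curvature, are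
of lower order than the square of the `(m + 2)`-nd derivative. -/
theorem exists_abs_arcInt_cubic_le {S C : ℝ} {m : ℕ} (hC : 0 ≤ C) (hS : 0 ≤ S) {f : ℝ × ℝ → ℝ}
    (hf : f ∈ cubic α (m + 2)) : ∃ K : ℝ, ∀ t q : ℝ, 0 ≤ t → 1 ≤ q →
      (∀ i, i ≤ m + 2 → nrm α i t ≤ C * q ^ i) →
      (∀ i, i ≤ m + 1 → ∀ u ∈ I, curv α i (u, t) ^ 2 ≤ S * q ^ (2 * i + 1)) →
      |arcInt α (fun p => f p * curv α m p) t| ≤ K * q ^ (2 * m + 3) := by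
  suffices H : ContDiffOn ℝ ∞ f domain ∧ ∃ K : ℝ, ∀ t q : ℝ, 0 ≤ t → 1 ≤ q →
      (∀ i, i ≤ m + 2 → nrm α i t ≤ C * q ^ i) →
      (∀ i, i ≤ m + 1 → ∀ u ∈ I, curv α i (u, t) ^ 2 ≤ S * q ^ (2 * i + 1)) →
      |arcInt α (fun p => f p * curv α m p) t| ≤ K * q ^ (2 * m + 3) from H.2
  have hm := h.smooth_curv m
  refine cubic_induction (P := fun f => ContDiffOn ℝ ∞ f domain ∧ ∃ K : ℝ, ∀ t q : ℝ, 0 ≤ t →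
      1 ≤ q → (∀ i, i ≤ m + 2 → nrm α i t ≤ C * q ^ i) →
      (∀ i, i ≤ m + 1 → ∀ u ∈ I, curv α i (u, t) ^ 2 ≤ S * q ^ (2 * i + 1)) →
      |arcInt α (fun p => f p * curv α m p) t| ≤ K * q ^ (2 * m + 3))
    (fun a b c hn => ⟨?_, S * C ^ 2, fun t q ht hq hN hsup => ?_⟩) ?_ ?_ ?_ hf
  · exact ((h.smooth_curv a).mul (h.smooth_curv b)).mul (h.smooth_curv c)
  · by_cases hc : c ≤ m + 1
    · exact h.abs_arcInt_quartic_le ht hC hS hq hN hsup hn hc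
    · have := h.abs_arcInt_quartic_le ht hC hS hq hN hsup (a := c) (b := b) (c := a)
        (by omega) (by omega)
      have e : (fun p => curv α a p * curv α b p * curv α c p * curv α m p) =
          fun p => curv α c p * curv α b p * curv α a p * curv α m p := by
        ext p; ring
      rwa [e]
  · exact ⟨contDiffOn_const, 0, fun t q _ _ _ _ => by simp [arcInt]⟩
  · rintro f g ⟨sf, Kf, hKf⟩ ⟨sg, Kg, hKg⟩
    refine ⟨sf.add sg, Kf + Kg, fun t q ht hq hN hsup => ?_⟩
    have e := h.arcInt_lincomb (sf.mul hm) (sg.mul hm) 1 1 ht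
    have e' : arcInt α (fun p => (f p + g p) * curv α m p) t =
        arcInt α (fun p => 1 * (f p * curv α m p) + 1 * (g p * curv α m p)) t := by
      congr 1; ext p; ring
    rw [e', e, one_mul, one_mul, add_mul]
    exact (abs_add_le _ _).trans (add_le_add (hKf t q ht hq hN hsup) (hKg t q ht hq hN hsup))
  · rintro a f ⟨sf, Kf, hKf⟩
    refine ⟨contDiffOn_const.mul sf, |a| * Kf, fun t q ht hq hN hsup => ?_⟩
    have e := h.arcInt_lincomb (sf.mul hm) (sf.mul hm) a 0 ht
    have e' : arcInt α (fun p => (a * f p) * curv α m p) t =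
        arcInt α (fun p => a * (f p * curv α m p) + 0 * (f p * curv α m p)) t := by
      congr 1; ext p; ring
    rw [e', e, zero_mul, add_zero, abs_mul, mul_assoc]
    exact mul_le_mul_of_nonneg_left (hKf t q ht hq hN hsup) (abs_nonneg a)

end IsRegularFamily

namespace IsNeumannFlow

variable {α : ℝ → ℝ → Plane} (h : IsNeumannFlow α) {t : ℝ}

include h

theorem sq_nrm_le_mul (i : ℕ) (ht : 0 ≤ t) :
    nrm α (i + 1) t ^ 2 ≤ nrm α i t * nrm α (i + 2) t := by
  have hr := h.toIsRegularFamily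
  have hodd : ∀ i : ℕ, i % 2 = 1 → curv α i (-1, t) = 0 ∧ curv α i (1, t) = 0 := by
    intro i hi
    have h1 := h.odd_left (i / 2) t ht
    have h2 := h.odd_right (i / 2) t ht
    rw [show 2 * (i / 2) + 1 = i by omega] at h1 h2
    exact ⟨h1, h2⟩
  have hb : curv α i (-1, t) * curv α (i + 1) (-1, t) = 0 ∧
      curv α i (1, t) * curv α (i + 1) (1, t) = 0 := by
    rcases Nat.mod_two_eq_zero_or_one i with hi | hi
    · rw [(hodd (i + 1) (by omega)).1, (hodd (i + 1) (by omega)).2]; simp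
    · rw [(hodd i hi).1, (hodd i hi).2]; simp
  have key := sq_integral_deriv_le (hr.slice_hasArcDeriv_curv i ht)
    (hr.slice_hasArcDeriv_curv (i + 1) ht) (hr.slice_spd_continuousOn ht)
    (hr.slice_spd_nonneg ht) hb.1 hb.2
  change arcInt α (fun p => curv α (i + 1) p ^ 2) t ^ 2 ≤
    arcInt α (fun p => curv α i p ^ 2) t * arcInt α (fun p => curv α (i + 2) p ^ 2) t at key
  rw [← hr.sq_nrm _ ht, ← hr.sq_nrm _ ht, ← hr.sq_nrm _ ht, ← mul_pow] at key
  exact le_of_sq_le_sq key (mul_nonneg (Real.sqrt_nonneg _) (Real.sqrt_nonneg _))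

theorem hasDerivAt_arcInt_curv_sq (m : ℕ) : ∃ f ∈ cubic α (m + 2), ∀ t, 0 < t →
    HasDerivAt (arcInt α fun p => curv α m p ^ 2)
      (-2 * nrm α (m + 2) t ^ 2 + arcInt α (fun p => f p * curv α m p) t) t := by
  have hr := h.toIsRegularFamily
  obtain ⟨f, hf, ef⟩ := h.toIsFlow.partialT_curv m
  have hg : (fun p => curv α 0 p * curv α 2 p * curv α m p) ∈ cubic α (m + 2) :=
    Submodule.subset_span ⟨0, 2, m, by omega, rfl⟩
  have hF := Submodule.add_mem _ (Submodule.smul_mem _ (2 : ℝ) hf) hg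
  refine ⟨_, hF, fun t ht => ?_⟩
  refine (h.toIsFlow.hasDerivAt_arcInt ((hr.smooth_curv m).pow 2) ht).congr_deriv ?_
  have e := hr.arcInt_lincomb ((hr.smooth_curv m).mul (hr.smooth_curv (m + 4)))
    ((hr.smooth_of_mem_cubic hF).mul (hr.smooth_curv m)) (-2) 1 ht.le
  rw [one_mul] at e
  rw [hr.sq_nrm _ ht.le, ← h.arcInt_curv_mul_curv m ht.le, ← e]
  refine arcInt_congr α (fun p hp => ?_) ht.le
  have := partialT_unique (F := fun p => curv α m p ^ 2) hp
    ((hasDerivWithinAt_partialT (hr.smooth_curv m) hp).pow 2)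
  rw [this, ef p hp]
  simp only [Prod.mk.eta, Pi.add_apply, Pi.smul_apply, smul_eq_mul]
  ring

/-- If the length is bounded below and the curvature is bounded in `L²`, all derivatives of the
curvature are bounded in `L²`. -/
theorem exists_arcInt_curv_sq_le {l E : ℝ} (hl : 0 < l) (hlen : ∀ t, 0 ≤ t → l ≤ len α t)
    (hE : ∀ t, 0 ≤ t → arcInt α (fun p => curv α 0 p ^ 2) t ≤ E) (m : ℕ) :
    ∃ B : ℝ, ∀ t, 0 ≤ t → arcInt α (fun p => curv α m p ^ 2) t ≤ B := by
  have hr := h.toIsRegularFamily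
  obtain ⟨f, hf, hderiv⟩ := h.hasDerivAt_arcInt_curv_sq m
  set C := max 1 √E
  have hC1 : 1 ≤ C := le_max_left _ _
  have hC : 0 ≤ C := by linarith
  have hS : 0 ≤ C ^ 2 * (1 / l + 2) := by positivity
  obtain ⟨K, hK⟩ := hr.exists_abs_arcInt_cubic_le hC hS hf
  set R := max 1 K
  have hR : 1 ≤ R := le_max_left _ _
  refine ⟨max (arcInt α (fun p => curv α m p ^ 2) 0) (C ^ 2 * R ^ (2 * m)), fun t ht => ?_⟩
  refine le_of_deriv_nonpos_above (hr.continuousOn_arcInt ((hr.smooth_curv m).pow 2)) hderiv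
    (le_max_left _ _) (fun s hs hlt => ?_) ht
  have hlt := lt_of_le_of_lt (le_max_right _ _) hlt
  set X := max 1 (nrm α (m + 2) s)
  have hX : 1 ≤ X := le_max_left _ _
  -- The size per derivative, so that interpolation reads `‖k_i‖ ≤ C q^i`.
  obtain ⟨q, hq, hqX⟩ : ∃ q : ℝ, 1 ≤ q ∧ q ^ (m + 2) = X :=
    ⟨X ^ (((m + 2 : ℕ) : ℝ)⁻¹), Real.one_le_rpow hX (by positivity),
      Real.rpow_inv_natCast_pow (by linarith) (by omega)⟩
  have hN : ∀ i, i ≤ m + 2 → nrm α i s ≤ C * q ^ i := fun i hi =>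
    le_mul_pow_of_sq_le_mul (N := fun i => nrm α i s) hC1 hq
      ((Real.sqrt_le_sqrt (hE s hs.le)).trans (le_max_right _ _))
      (by rw [hqX]; exact le_max_right _ _) (fun i => Real.sqrt_nonneg _)
      (fun i _ => h.sq_nrm_le_mul i hs.le) hi
  have hsup : ∀ i, i ≤ m + 1 → ∀ u ∈ I,
      curv α i (u, s) ^ 2 ≤ C ^ 2 * (1 / l + 2) * q ^ (2 * i + 1) := fun i hi =>
    hr.curv_sq_le hs.le hl (hlen s hs.le) hC hq (hN i (by omega)) (hN (i + 1) (by omega))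
  have hbound := (abs_le.1 (hK s q hs.le hq hN hsup)).2
  -- If `q ≤ R`, interpolation would put `‖k_m‖²` below the threshold `C² R^(2m)`. With `q > R ≥ K`
  -- the dissipation wins.
  have hRq : R < q := by
    by_contra! hle
    have h1 : arcInt α (fun p => curv α m p ^ 2) s ≤ C ^ 2 * R ^ (2 * m) := by
      rw [← hr.sq_nrm m hs.le]
      calc nrm α m s ^ 2 ≤ (C * q ^ m) ^ 2 :=
            pow_le_pow_left₀ (Real.sqrt_nonneg _) (hN m (by omega)) 2
        _ = C ^ 2 * q ^ (2 * m) := by ring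
        _ ≤ _ := by gcongr
    exact absurd h1 (not_le.2 hlt)
  have hX1 : nrm α (m + 2) s = q ^ (m + 2) := by
    have h1 : 1 < q ^ (m + 2) := one_lt_pow₀ (lt_of_le_of_lt hR hRq) (by omega)
    rw [hqX] at h1 ⊢
    rcases max_choice 1 (nrm α (m + 2) s) with h2 | h2
    · exact absurd (show X = 1 from h2) h1.ne'
    · exact h2.symm
  have hKq : K ≤ q := (le_max_right _ _).trans hRq.le
  rw [hX1]
  have hq3 : 0 < q ^ (2 * m + 3) := by positivity
  calc _ ≤ -2 * (q ^ (m + 2)) ^ 2 + K * q ^ (2 * m + 3) := by linarith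
    _ = (K - 2 * q) * q ^ (2 * m + 3) := by ring
    _ ≤ 0 := mul_nonpos_of_nonpos_of_nonneg (by linarith) hq3.le

end IsNeumannFlow

/-! ### The smallness condition -/

/-- The bound on the oscillation of curvature is the square of the positive root of a quadratic
equation. -/
theorem exists_oscBound_eq {w : ℝ} (hw0 : 0 < w) (hw : w < 1 / 2) : ∃ y : ℝ, 0 < y ∧
    oscBound w = y ^ 2 ∧ 6 / Real.pi * y ^ 2 + 24 * w * y = 2 * (1 - 4 * w ^ 2) := by
  have hpi := Real.pi_pos
  have h1 : 0 < 1 - 4 * w ^ 2 := by nlinarith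
  have h2 : 0 < 48 / Real.pi * (1 - 4 * w ^ 2) := by positivity
  have hD := Real.sq_sqrt (show 0 ≤ (24 * w) ^ 2 + 48 / Real.pi * (1 - 4 * w ^ 2) by positivity)
  have hz : 24 * w < √((24 * w) ^ 2 + 48 / Real.pi * (1 - 4 * w ^ 2)) :=
    Real.lt_sqrt_of_sq_lt (by linarith)
  unfold oscBound
  set D := √((24 * w) ^ 2 + 48 / Real.pi * (1 - 4 * w ^ 2))
  refine ⟨Real.pi / 12 * (-24 * w + D), mul_pos (by positivity) (by linarith), by ring, ?_⟩
  have h3 : Real.pi * (48 / Real.pi * (1 - 4 * w ^ 2)) = 48 * (1 - 4 * w ^ 2) := by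
    field_simp
  have h4 : 6 / Real.pi * (Real.pi / 12 * (-24 * w + D)) ^ 2 =
      Real.pi / 24 * (-24 * w + D) ^ 2 := by
    field_simp; ring
  rw [h4]
  linear_combination Real.pi / 24 * hD + h3 / 24

/-- The hypothesis has slack over what monotonicity needs, as `3/2 ≤ 6/π` and `6√2 ≤ 24`. The
barrier can therefore be `2y²`, strictly above the initial bound `y²`. -/
theorem oscBound_two_mul_le {w y : ℝ} (hw0 : 0 < w) (hy : 0 < y)
    (h : 6 / Real.pi * y ^ 2 + 24 * w * y = 2 * (1 - 4 * w ^ 2)) :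
    3 / 4 * (2 * y ^ 2) + 6 * w * √(2 * y ^ 2) ≤ 2 * (1 - 4 * w ^ 2) := by
  have hpi := Real.pi_pos
  have h1 : √(2 * y ^ 2) ≤ 2 * y := by
    apply Real.sqrt_le_iff.2 ⟨by positivity, by nlinarith⟩
  have h2 : 3 / 2 ≤ 6 / Real.pi := by
    rw [le_div_iff₀ hpi]; linarith [Real.pi_le_four]
  have h3 : 3 / 2 * y ^ 2 ≤ 6 / Real.pi * y ^ 2 := by gcongr
  have h4 : w * √(2 * y ^ 2) ≤ w * (2 * y) := by gcongr
  nlinarith [mul_pos hw0 hy]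

/-- At `y = π(1 - 2w)` the increasing quadratic already equals `6π(1 - 4w²)`, more than `2(1 -
4w²)`. This supplies the graph condition in `abs_angle_sub_lt`. -/
theorem oscBound_lt_angle {w y : ℝ} (hw0 : 0 < w) (hw : w < 1 / 2)
    (h : 6 / Real.pi * y ^ 2 + 24 * w * y = 2 * (1 - 4 * w ^ 2)) :
    y < Real.pi * (1 - 2 * w) := by
  have hpi := Real.pi_gt_three
  have hpi0 := Real.pi_pos
  by_contra! hle
  have hd : 0 < Real.pi * (1 - 2 * w) := mul_pos hpi0 (by linarith)
  have h1 : 6 / Real.pi * (Real.pi * (1 - 2 * w)) ^ 2 ≤ 6 / Real.pi * y ^ 2 := by gcongr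
  have h2 : 24 * w * (Real.pi * (1 - 2 * w)) ≤ 24 * w * y := by gcongr
  have h3 : 6 / Real.pi * (Real.pi * (1 - 2 * w)) ^ 2 = 6 * Real.pi * (1 - 2 * w) ^ 2 := by
    field_simp
  have h4 : 0 < 1 - 4 * w ^ 2 := by nlinarith
  have h5 : 6 * Real.pi * (1 - 2 * w) ^ 2 + 24 * w * (Real.pi * (1 - 2 * w)) =
      6 * Real.pi * (1 - 4 * w ^ 2) := by ring
  nlinarith

/-! ### Dependence on the values on the parameter interval -/

/-- The initial curve and the solution at time zero agree only on `[-1,1]`; these congruences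
transfer the hypotheses on `α₀` to the flow. -/
theorem arcDeriv_congr {E : Type} [NormedAddCommGroup E] [NormedSpace ℝ E] {c c' : ℝ → Plane}
    {f f' : ℝ → E} (hc : EqOn c c' I) (hf : EqOn f f' I) : EqOn (arcDeriv c f) (arcDeriv c' f') I :=
  fun u hu => by
    simp only [arcDeriv, speed]
    rw [derivWithin_congr hc (hc hu), derivWithin_congr hf (hf hu)]

theorem tangent_congr {c c' : ℝ → Plane} (hc : EqOn c c' I) : EqOn (tangent c) (tangent c') I :=
  arcDeriv_congr hc hc

theorem curvature_congr {c c' : ℝ → Plane} (hc : EqOn c c' I) :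
    EqOn (curvature c) (curvature c') I := fun u hu => by
  simp only [curvature, normal]
  rw [arcDeriv_congr hc (tangent_congr hc) hu, tangent_congr hc hu]

theorem arcIntegral_congr {c c' : ℝ → Plane} {f f' : ℝ → ℝ} (hc : EqOn c c' I) (hf : EqOn f f' I) :
    arcIntegral c f = arcIntegral c' f' := by
  apply intervalIntegral.integral_congr
  intro u hu
  rw [uIcc_of_le (by norm_num)] at hu
  simp only [speed]
  rw [hf hu, derivWithin_congr hc (hc hu)]

theorem length_congr {c c' : ℝ → Plane} (hc : EqOn c c' I) : length c = length c' :=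
  arcIntegral_congr hc fun _ _ => rfl

theorem rotationNumber_congr {c c' : ℝ → Plane} (hc : EqOn c c' I) :
    rotationNumber c = rotationNumber c' := by
  rw [rotationNumber, rotationNumber, arcIntegral_congr hc (curvature_congr hc)]

theorem curvatureOsc_congr {c c' : ℝ → Plane} (hc : EqOn c c' I) :
    curvatureOsc c = curvatureOsc c' := by
  have h1 : averageCurvature c = averageCurvature c' := by
    rw [averageCurvature, averageCurvature, length_congr hc,
      arcIntegral_congr hc (curvature_congr hc)]
  rw [curvatureOsc, curvatureOsc, length_congr hc,
    arcIntegral_congr hc fun u hu => by rw [curvature_congr hc hu, h1]]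

theorem IsRegularFamily.curvatureOsc_eq {α : ℝ → ℝ → Plane} (h : IsRegularFamily α) {t : ℝ}
    (ht : 0 ≤ t) : curvatureOsc (fun v => α v t) =
      len α t * arcInt α (fun p => curv α 0 p ^ 2) t - arcInt α (curv α 0) t ^ 2 := by
  have hL := h.len_pos ht
  have e : length (fun v => α v t) = len α t := arcInt_one α t
  have hc := (h.slice_hasArcDeriv_curv 0 ht).continuousOn
  have h1 := osc_eq (h.slice_spd_continuousOn ht) hc (averageCurvature fun v => α v t)
  have h2 : averageCurvature (fun v => α v t) = 1 / len α t * arcInt α (curv α 0) t := by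
    rw [averageCurvature, e]; rfl
  rw [curvatureOsc, e]
  change len α t * (∫ u in (-1 : ℝ)..1,
    (curv α 0 (u, t) - averageCurvature fun v => α v t) ^ 2 * spd α (u, t)) = _
  rw [h1, h2]
  change len α t * (arcInt α (fun p => curv α 0 p ^ 2) t - 2 * _ * arcInt α (curv α 0) t +
    _ ^ 2 * len α t) = _
  field_simp
  ring


/-! ### Uniform length and energy bounds, and the conclusion -/

/-- Along the flow the length is bounded below and the curvature is bounded in `L²`. -/
theorem exists_length_energy_bounds {θ₁ θ₂ : ℝ} (hθ₂ : 0 ≤ θ₂) (hθ : θ₂ < θ₁)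
    (hθ₁ : θ₁ < Real.pi) {α₀ : ℝ → Plane} (hα₀ : IsInitialCurve θ₁ θ₂ α₀) {α : ℝ → ℝ → Plane}
    (hα : IsGlobalSolution θ₁ θ₂ α₀ α) (hω_pos : 0 < rotationNumber α₀)
    (hω_lt : rotationNumber α₀ < 1 / 2)
    (hosc : curvatureOsc α₀ ≤ oscBound (rotationNumber α₀)) :
    ∃ l E : ℝ, 0 < l ∧ (∀ t, 0 ≤ t → l ≤ len α t) ∧
      ∀ t, 0 ≤ t → arcInt α (fun p => curv α 0 p ^ 2) t ≤ E := by
  have hpi := Real.pi_pos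
  have h := hα.isNeumannFlow
  have hr := h.toIsRegularFamily
  have hinit : EqOn α₀ (fun v => α v 0) I := fun u hu => (hα.initial u hu).symm
  set w := rotationNumber α₀ with hw
  have hW : arcInt α (curv α 0) 0 = 2 * Real.pi * w := by
    rw [hw, rotationNumber_congr hinit, rotationNumber, ← mul_assoc, mul_one_div_cancel (by positivity),
      one_mul]
    rfl
  obtain ⟨y, hy, hB, hquad⟩ := exists_oscBound_eq hω_pos hω_lt
  rw [curvatureOsc_congr hinit, hr.curvatureOsc_eq le_rfl, hW, hB] at hosc
  -- The initial bound is `y²`, the barrier `2 y²`.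
  have hosc_t := fun {t} ht => h.osc_le hω_pos.le hW (by nlinarith [pow_pos hy 2])
    (oscBound_two_mul_le hω_pos hy hquad) hosc (t := t) ht
  have hin : ∀ u ∈ Ioo (-1 : ℝ) 1, pos α (u, 0) ∈ sector θ₁ θ₂ := by
    intro u hu
    have := hα₀.inside u hu
    rwa [hinit (Ioo_subset_Icc_self hu)] at this
  have bc := fun t ht => hα.boundary t ht
  have hnor := hr.nor_left hθ₂ hθ₁ le_rfl hin (bc 0 le_rfl).left_mem (bc 0 le_rfl).left_perp
  obtain ⟨ψ, hψ0, hψ, hnψ⟩ := hr.exists_normal_angle le_rfl hnor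
  have hangle := hr.total_curvature_eq_angle hθ₂ hθ hθ₁ le_rfl hψ0 hψ hnψ (bc 0 le_rfl).right_perp
    (by rw [hW]; positivity) (by rw [hW]; nlinarith)
  have hlt : θ₁ - θ₂ < Real.pi := by linarith
  have hsmall : len α 0 * arcInt α (fun p => curv α 0 p ^ 2) 0 - (θ₁ - θ₂) ^ 2 <
      (Real.pi - (θ₁ - θ₂)) ^ 2 := by
    rw [← hangle, hW]
    refine lt_of_le_of_lt hosc ?_
    have := oscBound_lt_angle hω_pos hω_lt hquad
    exact pow_lt_pow_left₀ (by linarith) hy.le (by norm_num)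
  have harea := hr.area_pos le_rfl hθ hlt hnψ
    (fun u hu => hr.abs_angle_sub_lt le_rfl hψ0 hψ hangle hθ hlt hsmall hu) hin
    (bc 0 le_rfl).left_mem (bc 0 le_rfl).right_mem
  have hs : 0 < Real.sin (θ₁ - θ₂) := Real.sin_pos_of_pos_of_lt_pi (by linarith) hlt
  set R := 1 / Real.sin (θ₁ - θ₂) + 1
  have hR : 0 < R := by positivity
  set A := arcInt α (fun p => inner ℝ (pos α p) (nor α p)) 0
  have hAt : ∀ t, 0 ≤ t → A ≤ R * len α t ^ 2 := by
    intro t ht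
    have h1 := hr.area_le hs ht (bc t ht).left_mem (bc t ht).right_mem
    rwa [h.area_eq (fun s hs => ⟨hr.inner_pos_tan_eq_zero (mk_mem_domain left_mem_I hs)
      (bc s hs).left_perp (bc s hs).left_mem, hr.inner_pos_tan_eq_zero
      (mk_mem_domain right_mem_I hs) (bc s hs).right_perp (bc s hs).right_mem⟩) ht] at h1
  have hlpos : 0 < √(A / R) := Real.sqrt_pos.2 (by positivity)
  have hlen : ∀ t, 0 ≤ t → √(A / R) ≤ len α t := by
    intro t ht
    refine Real.sqrt_le_iff.2 ⟨(hr.len_pos ht).le, ?_⟩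
    rw [div_le_iff₀ hR]
    linarith [hAt t ht]
  refine ⟨√(A / R), (y ^ 2 + (2 * Real.pi * w) ^ 2) / √(A / R), hlpos, hlen, fun t ht => ?_⟩
  have h1 : arcInt α (fun p => curv α 0 p ^ 2) t ≤
      (y ^ 2 + (2 * Real.pi * w) ^ 2) / len α t := by
    rw [le_div_iff₀ (hr.len_pos ht)]
    linarith [hosc_t ht]
  refine h1.trans ?_
  have := hlen t ht
  gcongr

end ConeFlow

end

theorem corollary4p3 (θ₁ θ₂ : ℝ) (hθ₂ : 0 ≤ θ₂) (hθ : θ₂ < θ₁) (hθ₁ : θ₁ < Real.pi)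
    (α₀ : ℝ → ConeFlow.Plane) (hα₀ : ConeFlow.IsInitialCurve θ₁ θ₂ α₀)
    (α : ℝ → ℝ → ConeFlow.Plane) (hα : ConeFlow.IsGlobalSolution θ₁ θ₂ α₀ α)
    (hω_pos : 0 < ConeFlow.rotationNumber α₀)
    (hω_lt : ConeFlow.rotationNumber α₀ < 1 / 2)
    (hosc : ConeFlow.curvatureOsc α₀ ≤ ConeFlow.oscBound (ConeFlow.rotationNumber α₀)) :
    ∀ m : ℕ, ∃ C : ℝ, 0 < C ∧ ∀ t : ℝ, 0 ≤ t →
      ConeFlow.arcIntegral (fun v => α v t)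
        (fun u => ConeFlow.curvatureDeriv (fun v => α v t) m u ^ 2) ≤ C ^ 2 := by
  intro m
  obtain ⟨l, E, hl, hlen, hE⟩ :=
    ConeFlow.exists_length_energy_bounds hθ₂ hθ hθ₁ hα₀ hα hω_pos hω_lt hosc
  obtain ⟨B, hB⟩ := hα.isNeumannFlow.exists_arcInt_curv_sq_le hl hlen hE m
  -- A number that is at least `1` and at least `B` has a square at least `B`.
  refine ⟨max 1 B, lt_of_lt_of_le one_pos (le_max_left _ _), fun t ht => ?_⟩
  have h1 : ConeFlow.arcIntegral (fun v => α v t)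
      (fun u => ConeFlow.curvatureDeriv (fun v => α v t) m u ^ 2) ≤ B := hB t ht
  nlinarith [le_max_left 1 B, le_max_right 1 B]
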